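/- For $t=(t_0,t_1,t_2,t_3)\in\mathbb C^4$ let $\Delta(t)=t_0(27t_0t_3^2-t_2^3)$, let $T=\{t\in\mathbb C^4\mid\Delta(t)\neq 0\}$, and for $t\in T$ let $E_t\subset\mathbb C^2$ be the curve $y^2=4t_0(x-t_1)^3-t_2(x-t_1)-t_3$ with the differential forms $\omega_1=\frac{dx}{y}$, $\omega_2=\frac{x\,dx}{y}$. Let $U\subset T$ be open and let $\delta_1=\delta_{1,t}$, $\delta_2=\delta_{2,t}$, $t\in U$, be two continuous families of cycles in $E_t$, each represented by closed $C^1$ paths in $E_t$ depending continuously on $t$ (for instance, families forming a basis of $H_1(E_t,\mathbb Z)$ with $\langle\delta_1,\delta_2\rangle=1$). Then the period matrix $$\mathrm{pm}(t)=\frac1{\sqrt{2\pi i}}\begin{pmatrix}\int_{\delta_1}\omega_1&\int_{\delta_1}\omega_2\\ \int_{\delta_2}\omega_1&\int_{\delta_2}\omega_2\end{pmatrix}$$ is holomorphic on $U$ and satisfies $$d\,\mathrm{pm}(t)=\mathrm{pm}(t)\cdot A^{\mathrm{tr}},\qquad A=\frac1\Delta\sum_{i=0}^3A_i\,dt_i,$$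 where $$A_0=\begin{pmatrix}\frac32t_0t_1t_2t_3-9t_0t_3^2+\frac14t_2^3&-\frac32t_0t_2t_3\\ \frac32t_0t_1^2t_2t_3+9t_0t_1t_3^2-\frac12t_1t_2^3+\frac18t_2^2t_3&-\frac32t_0t_1t_2t_3-18t_0t_3^2+\frac34t_2^3\end{pmatrix},$$ $$A_1=\begin{pmatrix}0&0\\27t_0^2t_3^2-t_0t_2^3&0\end{pmatrix},$$ $$A_2=\begin{pmatrix}-\frac92t_0^2t_1t_3+\frac14t_0t_2^2&\frac92t_0^2t_3\\-\frac92t_0^2t_1^2t_3+\frac12t_0t_1t_2^2-\frac38t_0t_2t_3&\frac92t_0^2t_1t_3-\frac14t_0t_2^2\end{pmatrix},$$ $$A_3=\begin{pmatrix}3t_0^2t_1t_2-\frac92t_0^2t_3&-3t_0^2t_2\\3t_0^2t_1^2t_2-9t_0^2t_1t_3+\frac14t_0t_2^2&-3t_0^2t_1t_2+\frac92t_0^2t_3\end{pmatrix}.$$ Moreover, $A$ is the matrix of the algebraic Gauss–Manin connection $\nabla$ of the generic curve $E$ over $\mathbb Q(t)=\mathbb Q(t_0,t_1,t_2,t_3)$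 in the basis $(\omega_1,\omega_2)$ of $H^1_{\mathrm{dR}}(E)$: $\nabla\omega_j=\sum_kA_{jk}\otimes\omega_k$. That is, if $L=\mathbb Q(t)(x,y)$ is the function field of $E$ and $D$ is any derivation of $L$ extending $\frac{\partial}{\partial t_i}$ on $\mathbb Q(t)$, then for $i=0,\dots,3$ and $j=1,2$ the Lie derivative of $\omega_j$ along $D$, where $D$ acts on relative differentials by $f\,dg\mapsto D(f)\,dg+f\,d(D(g))$, equals $\frac1\Delta\sum_{k=1}^2(A_i)_{jk}\,\omega_k$ in $\Omega^1_{L/\mathbb Q(t)}$ modulo the exact forms $dh$, $h\in L$. -/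

import Mathlib

open Polynomial MeasureTheory
open scoped Topology

noncomputable section

namespace EllipticFamily

/-! ### The family and the explicit matrices, over an arbitrary field of parameters -/

/-- The cubic polynomial `4 t₀ (x - t₁)³ - t₂ (x - t₁) - t₃`. -/
def cubic {R : Type*} [Field R] (t : Fin 4 → R) : R[X] :=
  C (4 * t 0) * (X - C (t 1)) ^ 3 - C (t 2) * (X - C (t 1)) - C (t 3)

/-- The discriminant `Δ = t₀ (27 t₀ t₃² - t₂³)`. -/
def disc {R : Type*} [Field R] (t : Fin 4 → R) : R :=
  t 0 * (27 * t 0 * t 3 ^ 2 - t 2 ^ 3)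

/-- The polynomial matrices `A₀, A₁, A₂, A₃`. -/
def matA {R : Type*} [Field R] (t : Fin 4 → R) : Fin 4 → Matrix (Fin 2) (Fin 2) R :=
  ![!![3 / 2 * t 0 * t 1 * t 2 * t 3 - 9 * t 0 * t 3 ^ 2 + 1 / 4 * t 2 ^ 3,
        -(3 / 2) * t 0 * t 2 * t 3;
       3 / 2 * t 0 * t 1 ^ 2 * t 2 * t 3 + 9 * t 0 * t 1 * t 3 ^ 2
          - 1 / 2 * t 1 * t 2 ^ 3 + 1 / 8 * t 2 ^ 2 * t 3,
        -(3 / 2) * t 0 * t 1 * t 2 * t 3 - 18 * t 0 * t 3 ^ 2 + 3 / 4 * t 2 ^ 3],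
    !![0, 0;
       27 * t 0 ^ 2 * t 3 ^ 2 - t 0 * t 2 ^ 3, 0],
    !![-(9 / 2) * t 0 ^ 2 * t 1 * t 3 + 1 / 4 * t 0 * t 2 ^ 2,
        9 / 2 * t 0 ^ 2 * t 3;
       -(9 / 2) * t 0 ^ 2 * t 1 ^ 2 * t 3 + 1 / 2 * t 0 * t 1 * t 2 ^ 2
          - 3 / 8 * t 0 * t 2 * t 3,
        9 / 2 * t 0 ^ 2 * t 1 * t 3 - 1 / 4 * t 0 * t 2 ^ 2],
    !![3 * t 0 ^ 2 * t 1 * t 2 - 9 / 2 * t 0 ^ 2 * t 3,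
        -3 * t 0 ^ 2 * t 2;
       3 * t 0 ^ 2 * t 1 ^ 2 * t 2 - 9 * t 0 ^ 2 * t 1 * t 3 + 1 / 4 * t 0 * t 2 ^ 2,
        -3 * t 0 ^ 2 * t 1 * t 2 + 9 / 2 * t 0 ^ 2 * t 3]]

/-! ### Periods -/

/-- The parameter space `T = ℂ⁴ ∖ {Δ = 0}`. -/
def T : Set (Fin 4 → ℂ) := {t | disc t ≠ 0}

/-- The (affine) curve `E_t = {y² = 4 t₀ (x - t₁)³ - t₂ (x - t₁) - t₃}` in `ℂ²`. -/
def E (t : Fin 4 → ℂ) : Set (ℂ × ℂ) := {q | q.2 ^ 2 = (cubic t).eval q.1}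

/-- The regular 1-form `dx / y` on `E_t`. On `E_t` one has `2 y dy = p'(x) dx`, with `p` the cubic,
so at the points with `y = 0` the form `dx / y` is `2 dy / p'(x)`. -/
def dxOverY (t : Fin 4 → ℂ) (q : ℂ × ℂ) : ℂ × ℂ →L[ℂ] ℂ :=
  open Classical in
  if q.2 ≠ 0 then q.2⁻¹ • ContinuousLinearMap.fst ℂ ℂ ℂ
  else (2 / (cubic t).derivative.eval q.1) • ContinuousLinearMap.snd ℂ ℂ ℂ

/-- The 1-forms `ω₁ = dx / y` and `ω₂ = x dx / y` on `E_t` (indexed by `0` and `1`). -/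
def ω (t : Fin 4 → ℂ) (j : Fin 2) (q : ℂ × ℂ) : ℂ × ℂ →L[ℂ] ℂ :=
  q.1 ^ (j : ℕ) • dxOverY t q

/-- A continuous family of cycles `δ_t ⊂ E_t`, `t ∈ U`: closed `C¹` paths in `E_t` that depend
continuously on `t`. (As `E_t` is connected, every class in `H₁(E_t, ℤ)` is the class of such a
closed path.) The values for `t ∉ U` are irrelevant. -/
structure CycleFamily (U : Set (Fin 4 → ℂ)) where
  /-- the base point of the cycle in `E_t` -/
  base : (Fin 4 → ℂ) → ℂ × ℂ
  /-- the closed path `δ_t` -/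
  loop : ∀ t, Path (base t) (base t)
  mem_E : ∀ t ∈ U, ∀ s, loop t s ∈ E t
  contDiffOn : ∀ t ∈ U, ContDiffOn ℝ 1 (loop t).extend (Set.Icc 0 1)
  continuousOn : ContinuousOn (fun q : (Fin 4 → ℂ) × unitInterval => loop q.1 q.2)
    (U ×ˢ Set.univ)

/-- The period `∫_{δ_t} ω_j`. -/
def CycleFamily.period {U : Set (Fin 4 → ℂ)} (δ : CycleFamily U) (j : Fin 2)
    (t : Fin 4 → ℂ) : ℂ :=
  curveIntegral (ω t j) (δ.loop t)

/-- The period matrix `(2πi)^(-1/2) (∫_{δ_a} ω_b)_{a, b}`. -/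
def pm {U : Set (Fin 4 → ℂ)} (δ : Fin 2 → CycleFamily U) (t : Fin 4 → ℂ) :
    Matrix (Fin 2) (Fin 2) ℂ :=
  Matrix.of fun a b => 1 / (2 * (Real.pi : ℂ) * Complex.I) ^ (1 / 2 : ℂ) * (δ a).period b t

/-- The matrix of 1-forms `A = (1/Δ) ∑ A_i dt_i` on `T`. -/
def connA (t : Fin 4 → ℂ) : Matrix (Fin 2) (Fin 2) ((Fin 4 → ℂ) →L[ℂ] ℂ) :=
  Matrix.of fun j k =>
    (1 / disc t) • ∑ i : Fin 4, matA t i j k • ContinuousLinearMap.proj (R := ℂ) i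

/-! ### The algebraic Gauss-Manin connection -/

/-- The field `ℚ(t₀, t₁, t₂, t₃)`. -/
abbrev K : Type := FractionRing (MvPolynomial (Fin 4) ℚ)

/-- The generic parameter `(t₀, t₁, t₂, t₃)`, with coordinates in `ℚ(t)`. -/
def tK : Fin 4 → K := fun i => algebraMap (MvPolynomial (Fin 4) ℚ) K (MvPolynomial.X i)

/-- `L = ℚ(t)(x, y)` is the function field of the generic curve of the family. -/
structure IsFunctionField {L : Type*} [Field L] [Algebra K L] (x y : L) : Prop where
  transcendental : Transcendental K x
  equation : y ^ 2 = aeval x (cubic tK)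
  generates : IntermediateField.adjoin K {x, y} = ⊤

/-- `D` extends the derivation `∂/∂t_i` of `ℚ(t)` to `L`. (Derivations over `ℤ` of a field of
characteristic zero are the same as derivations over `ℚ`.) -/
def ExtendsPartial {L : Type*} [Field L] [Algebra K L] (i : Fin 4) (D : Derivation ℤ L L) : Prop :=
  ∀ q : MvPolynomial (Fin 4) ℚ,
    D (algebraMap K L (algebraMap _ K q)) = algebraMap K L (algebraMap _ K (MvPolynomial.pderiv i q))

/-- The relative 1-form `x ^ j dx / y` of `L` over `ℚ(t)`. -/
def ωK {L : Type*} [Field L] [Algebra K L] (x y : L) (j : Fin 2) : Ω[L⁄K] :=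
  (x ^ (j : ℕ) / y) • KaehlerDifferential.D K L x

/-- The Lie derivative `D(f) dg + f d(D g)` of the relative 1-form `f dg` along `D`. Modulo exact
forms, the Lie derivative along any extension of `∂/∂t_i` is the Gauss-Manin connection
`∇_{∂/∂t_i}`. -/
def lieDerivative {L : Type*} [Field L] [Algebra K L] (D : Derivation ℤ L L) (f g : L) : Ω[L⁄K] :=
  D f • KaehlerDifferential.D K L g + f • KaehlerDifferential.D K L (D g)

/-- The exact relative 1-forms `dh`, `h ∈ L`. -/
def exactForms (L : Type*) [Field L] [Algebra K L] : Submodule K Ω[L⁄K] :=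
  LinearMap.range (KaehlerDifferential.D K L).toLinearMap

end EllipticFamily

end

/-!
The Gauss–Manin connection is computed by an explicit lift `V_τ` of each direction `τ` of the
parameter space to the family of curves: `V_τ` has polynomial coefficients in `x` and `y`, and
`L_{V_τ} ω_j = ∑ k, A_{jk}(τ) ω_k + d(j c y)` for a constant `c` depending on `τ`. A derivation `D`
of the function field extending `∂/∂t_i` differs from the lift of `∂/∂t_i` by a vertical field,
which by Cartan's formula changes the Lie derivative of `ω_j` by an exact form.

For the periods, the identity is integrated locally on the curves. A local primitive of `ω_j` along
the curves satisfies the Gauss–Manin equation along `V_τ`, at a given parameter `t₀`, up to a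
constant on the curve; subtracting a function of `t` removes it. Two primitives corrected in this
way differ by a function of `t` whose derivative at `t₀` is given by the connection. A period is a
sum of increments of such primitives over short arcs of the cycle, and regrouping this sum by
division points exhibits it as a sum of functions of this kind, although the division points
themselves need not vary differentiably with `t`.
-/

noncomputable section

namespace EllipticFamily

section Polynomials

variable {F : Type*} [Field F] (t τ : Fin 4 → F)

/-- The derivative of the polynomial `cubic t` in the direction `τ` of the parameter space. -/
def cubicVariation : F[X] :=
  C (4 * τ 0) * (X - C (t 1)) ^ 3 + C (τ 1) * (C (t 2) - C (12 * t 0) * (X - C (t 1)) ^ 2)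
    - C (τ 2) * (X - C (t 1)) - C (τ 3)

/-- The Gauss–Manin matrix `(1/Δ) ∑ τᵢ Aᵢ` in the direction `τ`. -/
def connMatrix : Matrix (Fin 2) (Fin 2) F :=
  ∑ i, (τ i / disc t) • matA t i

/-- The polynomial `a_{j0} + a_{j1} x`, for `a` the Gauss–Manin matrix in the direction `τ`: the
form `∇_τ ω_j` is its product with `dx / y`. -/
def connPoly (j : Fin 2) : F[X] :=
  C (connMatrix t τ j 0) + C (connMatrix t τ j 1) * X

/-- The polynomial `R` such that `x ↦ -R(x)` is the first coordinate of the horizontal lift of `τ`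
to the family of curves. With `liftY`, it solves the Bézout equation `cubicVariation_eq`. -/
def liftX : F[X] :=
  C (disc t)⁻¹ *
    (C (τ 0) * (C (3 * t 0 * t 2 * t 3) * (X - C (t 1)) ^ 2
        + C (9 * t 0 * t 3 ^ 2 - 1 / 2 * t 2 ^ 3) * (X - C (t 1)) - C (1 / 2 * t 2 ^ 2 * t 3))
      - C (τ 1) * C (disc t)
      + C (τ 2) * (C (-9 * t 0 ^ 2 * t 3) * (X - C (t 1)) ^ 2
        + C (1 / 2 * t 0 * t 2 ^ 2) * (X - C (t 1)) + C (3 / 2 * t 0 * t 2 * t 3))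
      + C (τ 3) * (C (6 * t 0 ^ 2 * t 2) * (X - C (t 1)) ^ 2
        - C (9 * t 0 ^ 2 * t 3) * (X - C (t 1)) - C (t 0 * t 2 ^ 2)))

/-- The polynomial `W` such that `y ↦ -W(x) y` is the second coordinate of the horizontal lift of
`τ` to the family of curves. -/
def liftY : F[X] :=
  connPoly t τ 0 + derivative (liftX t τ)

/-- The constant `c` such that the Lie derivative of `x ^ j dx / y` along the horizontal lift of `τ`
is `∇_τ ω_j + d(j c y)`. -/
def exactCoeff : F :=
  (disc t)⁻¹ * (-(3 / 4) * τ 0 * t 2 * t 3 + 9 / 4 * τ 2 * t 0 * t 3 - 3 / 2 * τ 3 * t 0 * t 2)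

theorem derivative_cubic :
    derivative (cubic t) = C (12 * t 0) * (X - C (t 1)) ^ 2 - C (t 2) := by
  simp only [cubic, derivative_sub, derivative_mul, derivative_C, derivative_pow, derivative_X,
    map_mul, map_ofNat, Nat.cast_ofNat, derivative_ofNat]
  ring

theorem connMatrix_single (i : Fin 4) :
    connMatrix t (Pi.single i 1) = (1 / disc t) • matA t i := by
  rw [connMatrix, Finset.sum_eq_single i (fun k _ hk => by simp [hk]) (by simp), Pi.single_eq_same]

variable {t} [CharZero F]

theorem cubic_ne_zero (ht : disc t ≠ 0) : cubic t ≠ 0 := by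
  intro h
  have h_eval (u : F) : 12 * t 0 * (u - t 1) ^ 2 - t 2 = 0 := by
    simpa [h] using (congrArg (eval u) (derivative_cubic t)).symm
  have h_t0 : t 0 = 0 := by linear_combination (h_eval (t 1 + 1) - h_eval (t 1)) / 12
  exact ht (by rw [disc, h_t0, zero_mul])

theorem cubicVariation_eq (ht : disc t ≠ 0) :
    cubicVariation t τ =
      liftX t τ * derivative (cubic t) - 2 * liftY t τ * cubic t := by
  rw [derivative_cubic]
  refine Polynomial.funext fun x => ?_
  simp only [cubicVariation, liftX, liftY, connPoly, connMatrix, cubic, matA, Fin.sum_univ_four,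
    Matrix.add_apply, Matrix.smul_apply, smul_eq_mul, Matrix.of_apply, Matrix.cons_val,
    derivative_add, derivative_sub, derivative_mul, derivative_pow, derivative_C, derivative_X,
    eval_add, eval_sub, eval_mul, eval_pow, eval_C, eval_X, eval_ofNat, eval_zero, eval_one,
    Nat.cast_ofNat]
  field_simp
  rw [disc]
  ring

theorem X_pow_mul_connPoly_zero (ht : disc t ≠ 0) (j : Fin 2) :
    X ^ (j : ℕ) * connPoly t τ 0 - derivative (X ^ (j : ℕ)) * liftX t τ =
      connPoly t τ j + C (j * exactCoeff t τ / 2) * derivative (cubic t) := by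
  fin_cases j
  · simp
  refine Polynomial.funext fun x => ?_
  simp only [Fin.mk_one, pow_one, derivative_X, Nat.cast_one, one_mul,
    derivative_cubic, liftX, connPoly, connMatrix, matA, exactCoeff,
    Fin.sum_univ_four, Matrix.add_apply, Matrix.smul_apply, smul_eq_mul, Matrix.of_apply,
    Matrix.cons_val, eval_add, eval_sub, eval_mul, eval_pow, eval_C, eval_X]
  field_simp
  rw [disc]
  ring

end Polynomials

section AlgebraicConnection

variable {F L : Type*} [Field F] [Field L] [Algebra F L]

theorem map_aeval_cubic {D : Derivation ℤ L L} {t τ : Fin 4 → F}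
    (hD : ∀ i, D (algebraMap F L (t i)) = algebraMap F L (τ i)) (x : L) :
    D (aeval x (cubic t)) =
      aeval x (cubicVariation t τ) + aeval x (derivative (cubic t)) * D x := by
  have hD4 : D 4 = 0 := by simpa using D.map_natCast 4
  rw [derivative_cubic]
  simp only [cubic, cubicVariation, map_sub, map_add, map_mul, map_pow, aeval_C, aeval_X,
    Derivation.leibniz, Derivation.leibniz_pow, smul_eq_mul, nsmul_eq_mul, hD, map_ofNat, hD4]
  push_cast
  ring

section Curve

variable [CharZero F] {t : Fin 4 → F} {x y : L}

theorem kaehler_D_eq_of_sq_eq (hxy : y ^ 2 = aeval x (cubic t)) (hy : y ≠ 0) :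
    KaehlerDifferential.D F L y =
      (aeval x (derivative (cubic t)) / (2 * y)) • KaehlerDifferential.D F L x := by
  have : CharZero L := charZero_of_injective_algebraMap (algebraMap F L).injective
  have h := congrArg (KaehlerDifferential.D F L) hxy
  rw [Derivation.map_aeval, Derivation.leibniz_pow, pow_one, ← Nat.cast_smul_eq_nsmul L,
    smul_smul] at h
  rw [div_eq_inv_mul, mul_smul, ← h, smul_smul, Nat.cast_ofNat,
    inv_mul_cancel₀ (mul_ne_zero two_ne_zero hy), one_smul]

/-- The right-hand side displays `D` as its horizontal part `y ↦ -W(x) y` plus the vertical field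
with first component `D x + R(x)`. -/
theorem derivation_eq_of_sq_eq {D : Derivation ℤ L L} {τ : Fin 4 → F} (ht : disc t ≠ 0)
    (hD : ∀ i, D (algebraMap F L (t i)) = algebraMap F L (τ i))
    (hxy : y ^ 2 = aeval x (cubic t)) (hy : y ≠ 0) :
    D y = aeval x (derivative (cubic t)) / (2 * y) * (D x + aeval x (liftX t τ))
      - aeval x (liftY t τ) * y := by
  have : CharZero L := charZero_of_injective_algebraMap (algebraMap F L).injective
  have h := congrArg D hxy
  rw [map_aeval_cubic hD, cubicVariation_eq τ ht, Derivation.leibniz_pow, pow_one, smul_eq_mul,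
    nsmul_eq_mul, Nat.cast_ofNat] at h
  simp only [map_sub, map_mul, map_ofNat, ← hxy] at h
  field_simp
  linear_combination h

end Curve

section GenericCurve

variable [Algebra K L] {x y : L}

instance : CharZero K := algebraRat.charZero K

theorem disc_tK_ne_zero : disc tK ≠ 0 := by
  have h : disc tK = algebraMap (MvPolynomial (Fin 4) ℚ) K
      (MvPolynomial.X 0 *
        (27 * MvPolynomial.X 0 * MvPolynomial.X 3 ^ 2 - MvPolynomial.X 2 ^ 3)) := by
    simp only [disc, tK, map_sub, map_mul, map_pow, map_ofNat]
  rw [h, Ne, FaithfulSMul.algebraMap_eq_zero_iff]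
  intro h0
  simpa using congrArg (MvPolynomial.eval ![1, 0, 0, 1]) h0

theorem ExtendsPartial.map_tK {i : Fin 4} {D : Derivation ℤ L L} (hD : ExtendsPartial i D)
    (m : Fin 4) :
    D (algebraMap K L (tK m)) = algebraMap K L ((Pi.single i 1 : Fin 4 → K) m) := by
  rw [tK, hD, MvPolynomial.pderiv_X, Pi.single_apply, Pi.single_apply]
  split_ifs <;> simp

theorem IsFunctionField.y_ne_zero (h : IsFunctionField x y) : y ≠ 0 := by
  rintro rfl
  refine cubic_ne_zero disc_tK_ne_zero (transcendental_iff.1 h.transcendental _ ?_)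
  rw [← h.equation, zero_pow two_ne_zero]

theorem sum_connMatrix_smul_ωK (τ : Fin 4 → K) (j : Fin 2) :
    ∑ k, connMatrix tK τ j k • ωK x y k =
      (aeval x (connPoly tK τ j) / y) • KaehlerDifferential.D K L x := by
  simp only [ωK, connPoly, algebra_compatible_smul L (_ : K), smul_smul, Fin.sum_univ_two,
    ← add_smul, map_add, map_mul, aeval_C, aeval_X]
  congr 1
  simp only [Fin.val_zero, Fin.val_one]
  ring

/-- In the exact term, `x ^ j / y * (D x + R(x))` is the contraction of `ω_j` with the vertical part
of `D`, as in Cartan's formula. -/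
theorem lieDerivative_eq (h : IsFunctionField x y) {τ : Fin 4 → K} {D : Derivation ℤ L L}
    (hD : ∀ m, D (algebraMap K L (tK m)) = algebraMap K L (τ m)) (j : Fin 2) :
    lieDerivative D (x ^ (j : ℕ) / y) x =
      ∑ k, connMatrix tK τ j k • ωK x y k +
        KaehlerDifferential.D K L (x ^ (j : ℕ) / y * (D x + aeval x (liftX tK τ))
          + algebraMap K L (j * exactCoeff tK τ) * y) := by
  have hy := h.y_ne_zero
  have : CharZero L := charZero_of_injective_algebraMap (algebraMap K L).injective
  set dx := KaehlerDifferential.D K L x with hdx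
  have hDpow : D (x ^ (j : ℕ)) = aeval x (derivative (X ^ (j : ℕ) : K[X])) * D x := by
    simp [Derivation.leibniz_pow, derivative_X_pow, mul_assoc]
  have hdpow : KaehlerDifferential.D K L (x ^ (j : ℕ)) =
      aeval x (derivative (X ^ (j : ℕ) : K[X])) • dx := by
    simpa using Derivation.map_aeval (KaehlerDifferential.D K L) (X ^ (j : ℕ)) x
  have hred := congrArg (aeval x) (X_pow_mul_connPoly_zero τ disc_tK_ne_zero j)
  rw [sum_connMatrix_smul_ωK, lieDerivative, Derivation.leibniz_div, hDpow,
    derivation_eq_of_sq_eq disc_tK_ne_zero hD h.equation hy, map_add, Derivation.leibniz,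
    Derivation.leibniz, Derivation.leibniz_div, Derivation.map_algebraMap, hdpow, map_add,
    Derivation.map_aeval, kaehler_D_eq_of_sq_eq h.equation hy, liftY, ← hdx]
  simp only [map_sub, map_add, map_mul, map_pow, aeval_X, aeval_C, map_div₀, map_ofNat,
    map_natCast, smul_eq_mul] at hred ⊢
  match_scalars
  · field_simp
    linear_combination (2 * y ^ 2) * hred
  · ring

theorem mkQ_lieDerivative (h : IsFunctionField x y) {i : Fin 4} {D : Derivation ℤ L L}
    (hD : ExtendsPartial i D) (j : Fin 2) :
    (exactForms L).mkQ (lieDerivative D (x ^ (j : ℕ) / y) x) =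
      ∑ k, (1 / disc tK * matA tK i j k) • (exactForms L).mkQ (ωK x y k) := by
  have h_exact (f : L) : (exactForms L).mkQ (KaehlerDifferential.D K L f) = 0 := by
    rw [Submodule.mkQ_apply, Submodule.Quotient.mk_eq_zero]
    exact ⟨f, rfl⟩
  rw [lieDerivative_eq h hD.map_tK, map_add, h_exact, add_zero, map_sum]
  refine Finset.sum_congr rfl fun k _ => ?_
  rw [map_smul, connMatrix_single]
  rfl

end GenericCurve

end AlgebraicConnection

section ParametricPrimitive

open Metric

theorem hasFDerivAt_intervalIntegral_of_continuousOn {𝕜 H V : Type*} [RCLike 𝕜]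
    [NormedAddCommGroup H] [NormedSpace 𝕜 H] [NormedAddCommGroup V] [NormedSpace ℝ V]
    [NormedSpace 𝕜 V] {f : H → ℝ → V} {f' : H → ℝ → H →L[𝕜] V} {s : Set H} {x₀ : H} {a b : ℝ}
    (hs : s ∈ 𝓝 x₀) (hf : ∀ x ∈ s, ContinuousOn (f x) (Set.uIcc a b))
    (hf' : ContinuousOn (Function.uncurry f') (s ×ˢ Set.uIcc a b))
    (hderiv : ∀ x ∈ s, ∀ v ∈ Set.uIcc a b, HasFDerivAt (f · v) (f' x v) x) :
    HasFDerivAt (fun x => ∫ v in a..b, f x v) (∫ v in a..b, f' x₀ v) x₀ := by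
  have hf'_curry {x : H} (hx : x ∈ s) : ContinuousOn (f' x) (Set.uIcc a b) :=
    hf'.comp (Continuous.prodMk_right x).continuousOn fun v hv => ⟨hx, hv⟩
  have hx₀ := mem_of_mem_nhds hs
  obtain ⟨M, hM⟩ := isCompact_uIcc.exists_bound_of_continuousOn (hf'_curry hx₀)
  have h_bound : ∀ᶠ x in 𝓝 x₀, ∀ v ∈ Set.uIcc a b, ‖f' x v‖ ≤ M + 1 := by
    have h : ∀ᶠ x in 𝓝 x₀, ∀ v ∈ Set.uIcc a b, x ∈ s ∧ v ∈ Set.uIcc a b → ‖f' x v‖ ≤ M + 1 := by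
      refine isCompact_uIcc.eventually_forall_of_forall_eventually fun v hv => ?_
      exact eventually_nhdsWithin_iff.1 <| ((hf' (x₀, v) ⟨hx₀, hv⟩).norm.eventually_lt_const
        (lt_of_le_of_lt (hM v hv) (lt_add_one M))).mono fun _ hz => hz.le
    filter_upwards [h, hs] with x hx hxs v hv using hx v hv ⟨hxs, hv⟩
  refine intervalIntegral.hasFDerivAt_integral_of_dominated_of_fderiv_le
    (bound := fun _ => M + 1) (Filter.inter_mem hs h_bound)
    (Filter.eventually_of_mem hs fun x hx => ?_) (hf x₀ hx₀).intervalIntegrable ?_ ?_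
    intervalIntegrable_const ?_
  · exact ((hf x hx).mono Set.uIoc_subset_uIcc).aestronglyMeasurable measurableSet_uIoc
  · exact ((hf'_curry hx₀).mono Set.uIoc_subset_uIcc).aestronglyMeasurable measurableSet_uIoc
  · exact .of_forall fun v hv x hx => hx.2 v (Set.uIoc_subset_uIcc hv)
  · exact .of_forall fun v hv x hx => hderiv x hx.1 v (Set.uIoc_subset_uIcc hv)

variable {H : Type*}

/-- The primitive of `g` in the last variable obtained by integration along segments from `u₀`. -/
def radialPrimitive (u₀ : ℂ) (g : H × ℂ → ℂ) (z : H × ℂ) : ℂ :=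
  ∫ᶜ u in .segment u₀ z.2, g (z.1, u) • (1 : ℂ →L[ℂ] ℂ)

/-- The point at time `v` of the segment from `(z.1, u₀)` to `z`. -/
def segmentPoint (u₀ : ℂ) (z : H × ℂ) (v : ℝ) : H × ℂ :=
  (z.1, AffineMap.lineMap u₀ z.2 v)

theorem radialPrimitive_eq_integral (u₀ : ℂ) (g : H × ℂ → ℂ) (z : H × ℂ) :
    radialPrimitive u₀ g z = ∫ v in (0 : ℝ)..1, g (segmentPoint u₀ z v) * (z.2 - u₀) := by
  simp [radialPrimitive, curveIntegral_segment, segmentPoint]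

theorem hasDerivAt_radialPrimitive {u₀ u : ℂ} {g : H × ℂ → ℂ} {t : H} {r : ℝ}
    (hg : DifferentiableOn ℂ (fun u => g (t, u)) (ball u₀ r)) (hu : u ∈ ball u₀ r) :
    HasDerivAt (fun u => radialPrimitive u₀ g (t, u)) (g (t, u)) u := by
  have h_form (v : ℂ) (hv : v ∈ ball u₀ r) :=
    ((hg v hv).hasDerivWithinAt.hasFDerivWithinAt.smul_const (1 : ℂ →L[ℂ] ℂ)).restrictScalars ℝ
  have h := Convex.hasFDerivWithinAt_curveIntegral_segment_of_hasFDerivWithinAt_symmetric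
    (convex_ball u₀ r) h_form (fun a _ v _ w _ => ?_)
    (mem_ball_self (dist_nonneg.trans_lt (mem_ball.1 hu))) hu
  · simpa [radialPrimitive] using (h.hasFDerivAt (isOpen_ball.mem_nhds hu)).hasDerivAt
  · simp only [ContinuousLinearMap.coe_restrictScalars', ContinuousLinearMap.smulRight_apply,
      ContinuousLinearMap.toSpanSingleton_apply, smul_apply, smul_eq_mul, one_apply_eq_self]
    ring

theorem continuous_segmentPoint [TopologicalSpace H] (u₀ : ℂ) :
    Continuous (Function.uncurry (segmentPoint (H := H) u₀)) := by
  simp only [segmentPoint, Function.uncurry_def, AffineMap.lineMap_apply_module]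
  fun_prop

theorem mapsTo_segmentPoint [PseudoMetricSpace H] (t₀ : H) (u₀ : ℂ) (ρ : ℝ) :
    Set.MapsTo (Function.uncurry (segmentPoint u₀)) (ball (t₀, u₀) ρ ×ˢ Set.uIcc 0 1)
      (ball (t₀, u₀) ρ) := by
  rintro ⟨z, v⟩ ⟨hz, hv⟩
  rw [← ball_prod_same] at hz ⊢
  rw [Set.uIcc_of_le zero_le_one] at hv
  exact ⟨hz.1, (convex_ball u₀ ρ).lineMap_mem (mem_ball_self (dist_nonneg.trans_lt hz.2)) hz.2 hv⟩

theorem hasFDerivAt_segmentPoint [NormedAddCommGroup H] [NormedSpace ℂ H] (u₀ : ℂ) (z : H × ℂ)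
    (v : ℝ) :
    HasFDerivAt (segmentPoint u₀ · v)
      ((ContinuousLinearMap.inl ℂ H ℂ).comp (ContinuousLinearMap.fst ℂ H ℂ) +
        (v : ℂ) • (ContinuousLinearMap.inr ℂ H ℂ).comp (ContinuousLinearMap.snd ℂ H ℂ)) z := by
  refine ((ContinuousLinearMap.hasFDerivAt _).const_add (0, (1 - v) * u₀)).congr_of_eventuallyEq
    (.of_forall fun w => ?_)
  ext <;> simp [segmentPoint, AffineMap.lineMap_apply_module]

variable [NormedAddCommGroup H] [NormedSpace ℂ H] {g : H × ℂ → ℂ} {t₀ : H} {u₀ : ℂ}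

theorem hasFDerivAt_radialPrimitive {ρ : ℝ} (hg : ContDiffOn ℂ 1 g (ball (t₀, u₀) ρ)) {z : H × ℂ}
    (hz : z ∈ ball (t₀, u₀) ρ) :
    ∃ P' : H × ℂ →L[ℂ] ℂ, HasFDerivAt (radialPrimitive u₀ g) P' z ∧
      ∀ τ, P' (τ, 0) = radialPrimitive u₀ (fun w => fderiv ℂ g w (τ, 0)) z := by
  have hpt_cont := (continuous_segmentPoint (H := H) u₀).continuousOn
    (s := ball (t₀, u₀) ρ ×ˢ Set.uIcc 0 1)
  have hpt_mem := mapsTo_segmentPoint t₀ u₀ ρ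
  have hg_cont := hg.continuousOn.comp hpt_cont hpt_mem
  have hg'_cont := (hg.continuousOn_fderiv_of_isOpen isOpen_ball le_rfl).comp hpt_cont hpt_mem
  set seg : ℝ → H × ℂ →L[ℂ] H × ℂ := fun v =>
    (ContinuousLinearMap.inl ℂ H ℂ).comp (ContinuousLinearMap.fst ℂ H ℂ) +
      (v : ℂ) • (ContinuousLinearMap.inr ℂ H ℂ).comp (ContinuousLinearMap.snd ℂ H ℂ) with hseg
  set f' : H × ℂ → ℝ → H × ℂ →L[ℂ] ℂ := fun w v =>
    g (segmentPoint u₀ w v) • ContinuousLinearMap.snd ℂ H ℂ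
      + (w.2 - u₀) • (fderiv ℂ g (segmentPoint u₀ w v)).comp (seg v) with hf'
  have hf'_cont : ContinuousOn (Function.uncurry f') (ball (t₀, u₀) ρ ×ˢ Set.uIcc 0 1) := by
    have hseg_cont : Continuous fun q : (H × ℂ) × ℝ => seg q.2 := by fun_prop
    have hsub_cont : Continuous fun q : (H × ℂ) × ℝ => q.1.2 - u₀ := by fun_prop
    exact (hg_cont.smul continuousOn_const).add
      (hsub_cont.continuousOn.smul (hg'_cont.clm_comp hseg_cont.continuousOn))
  have hf'_deriv (w : H × ℂ) (hw : w ∈ ball (t₀, u₀) ρ) (v : ℝ) (hv : v ∈ Set.uIcc (0 : ℝ) 1) :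
      HasFDerivAt (fun w => g (segmentPoint u₀ w v) * (w.2 - u₀)) (f' w v) w := by
    have hg_deriv := ((hg.differentiableOn one_ne_zero).differentiableAt
      (isOpen_ball.mem_nhds (hpt_mem (Set.mk_mem_prod hw hv)))).hasFDerivAt
    exact (hg_deriv.comp w (hasFDerivAt_segmentPoint u₀ w v)).mul (hasFDerivAt_snd.sub_const u₀)
  have hf'_int : IntervalIntegrable (f' z) volume 0 1 :=
    (hf'_cont.comp (Continuous.prodMk_right z).continuousOn
      fun v hv => ⟨hz, hv⟩).intervalIntegrable
  refine ⟨∫ v in (0 : ℝ)..1, f' z v, ?_, fun τ => ?_⟩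
  · rw [funext (radialPrimitive_eq_integral u₀ g)]
    refine hasFDerivAt_intervalIntegral_of_continuousOn (isOpen_ball.mem_nhds hz)
      (fun w hw => ?_) hf'_cont hf'_deriv
    exact (hg_cont.comp (Continuous.prodMk_right w).continuousOn
      fun v hv => ⟨hw, hv⟩).mul continuousOn_const
  · rw [ContinuousLinearMap.intervalIntegral_apply hf'_int, radialPrimitive_eq_integral]
    simp [hf', hseg, mul_comm, Prod.mk_zero_zero]

/-- At `z`, the function `P` is a primitive of `g` in the last variable, and differentiation in this
variable commutes with differentiation in the parameters. -/
structure IsParametricPrimitiveAt (P g : H × ℂ → ℂ) (z : H × ℂ) : Prop where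
  differentiableAt : DifferentiableAt ℂ P z
  fderiv_vertical : fderiv ℂ P z (0, 1) = g z
  hasDerivAt_fderiv : ∀ τ,
    HasDerivAt (fun u => fderiv ℂ P (z.1, u) (τ, 0)) (fderiv ℂ g z (τ, 0)) z.2

theorem clm_apply_prodMk (f' : H × ℂ →L[ℂ] ℂ) (τ : H) (ν : ℂ) :
    f' (τ, ν) = f' (τ, 0) + ν * f' (0, 1) := by
  rw [← smul_eq_mul, ← map_smul, ← map_add]
  simp

theorem hasDerivAt_slice {V : Type*} [NormedAddCommGroup V] [NormedSpace ℂ V] {f : H × ℂ → V}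
    {t : H} {u : ℂ} (hf : DifferentiableAt ℂ f (t, u)) :
    HasDerivAt (fun u => f (t, u)) (fderiv ℂ f (t, u) (0, 1)) u :=
  hf.hasFDerivAt.comp_hasDerivAt u ((hasDerivAt_const u t).prodMk (hasDerivAt_id u))

theorem exists_isParametricPrimitiveAt (hg : ContDiffAt ℂ 2 g (t₀, u₀)) :
    ∃ P : H × ℂ → ℂ, ∀ᶠ z in 𝓝 (t₀, u₀), IsParametricPrimitiveAt P g z := by
  obtain ⟨ρ, hρ, hg⟩ : ∃ ρ > 0, ContDiffOn ℂ 2 g (ball (t₀, u₀) ρ) := by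
    obtain ⟨s, hs, hg⟩ := (hg.eventually (by simp)).exists_mem
    obtain ⟨ρ, hρ, hsub⟩ := Metric.mem_nhds_iff.1 hs
    exact ⟨ρ, hρ, fun z hz => (hg z (hsub hz)).contDiffWithinAt⟩
  have h_slice {f : H × ℂ → ℂ} (hf : DifferentiableOn ℂ f (ball (t₀, u₀) ρ)) {t : H}
      (ht : t ∈ ball t₀ ρ) : DifferentiableOn ℂ (fun u => f (t, u)) (ball u₀ ρ) :=
    hf.comp (by fun_prop) fun u hu => by rw [← ball_prod_same]; exact ⟨ht, hu⟩
  have h_deriv {t : H} (ht : t ∈ ball t₀ ρ) {u : ℂ} (hu : u ∈ ball u₀ ρ) :=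
    hasFDerivAt_radialPrimitive (hg.of_le one_le_two) (z := (t, u))
      (by rw [← ball_prod_same]; exact ⟨ht, hu⟩)
  refine ⟨radialPrimitive u₀ g, Filter.eventually_of_mem (ball_mem_nhds (t₀, u₀) hρ) ?_⟩
  rintro ⟨t, u⟩ hz
  obtain ⟨ht, hu⟩ : (t, u) ∈ ball t₀ ρ ×ˢ ball u₀ ρ := by rwa [ball_prod_same]
  obtain ⟨P', hP', -⟩ := h_deriv ht hu
  refine ⟨hP'.differentiableAt, ?_, fun τ => ?_⟩
  · exact (hasDerivAt_slice hP'.differentiableAt).unique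
      (hasDerivAt_radialPrimitive (h_slice (hg.differentiableOn two_ne_zero) ht) hu)
  · have hg' : DifferentiableOn ℂ (fun w => fderiv ℂ g w (τ, 0)) (ball (t₀, u₀) ρ) :=
      ((hg.fderiv_of_isOpen (m := 1) isOpen_ball (by norm_num)).differentiableOn
        one_ne_zero).clm_apply (differentiableOn_const _)
    refine (hasDerivAt_radialPrimitive (g := fun w => fderiv ℂ g w (τ, 0)) (h_slice hg' ht)
      hu).congr_of_eventuallyEq ?_
    filter_upwards [isOpen_ball.mem_nhds hu] with v hv
    obtain ⟨Q', hQ', h_horizontal⟩ := h_deriv ht hv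
    rw [hQ'.fderiv, h_horizontal]

end ParametricPrimitive

section TotalSpace

variable {t τ : Fin 4 → ℂ} {q v : ℂ × ℂ} {j k : Fin 2}

theorem isOpen_T : IsOpen T := by
  have h : Continuous (disc : (Fin 4 → ℂ) → ℂ) := by
    unfold disc
    fun_prop
  exact isOpen_ne_fun h continuous_const

theorem eval_cubic (t : Fin 4 → ℂ) (x : ℂ) :
    (cubic t).eval x = 4 * t 0 * (x - t 1) ^ 3 - t 2 * (x - t 1) - t 3 := by
  simp [cubic]

theorem eval_derivative_cubic (t : Fin 4 → ℂ) (x : ℂ) :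
    (derivative (cubic t)).eval x = 12 * t 0 * (x - t 1) ^ 2 - t 2 := by
  simp [derivative_cubic]

theorem fderiv_fst_apply_coord {ι V : Type*} [NormedAddCommGroup V] [NormedSpace ℂ V]
    (z : (ι → ℂ) × V) (i : ι) :
    fderiv ℂ (fun z : (ι → ℂ) × V => z.1 i) z =
      (ContinuousLinearMap.proj i).comp (ContinuousLinearMap.fst ℂ (ι → ℂ) V) :=
  ((ContinuousLinearMap.proj i).comp (ContinuousLinearMap.fst ℂ (ι → ℂ) V)).fderiv

/-- The defining equation of the total space `{(t, q) | q ∈ E t}` of the family. -/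
def curveEq (z : (Fin 4 → ℂ) × ℂ × ℂ) : ℂ := z.2.2 ^ 2 - (cubic z.1).eval z.2.1

theorem mem_E_iff : q ∈ E t ↔ curveEq (t, q) = 0 :=
  sub_eq_zero.symm

theorem contDiff_curveEq {n : WithTop ℕ∞} : ContDiff ℂ n curveEq := by
  unfold curveEq
  simp only [eval_cubic]
  fun_prop

/-- `(τ, v)` is tangent at `(t, q)` to the total space of the family of curves. -/
def IsTangent (t : Fin 4 → ℂ) (q : ℂ × ℂ) (τ : Fin 4 → ℂ) (v : ℂ × ℂ) : Prop :=
  2 * q.2 * v.2 = (cubicVariation t τ).eval q.1 + (derivative (cubic t)).eval q.1 * v.1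

theorem isTangent_iff : IsTangent t q τ v ↔ fderiv ℂ curveEq (t, q) (τ, v) = 0 := by
  unfold curveEq
  simp only [eval_cubic]
  simp (disch := fun_prop) only [fderiv_fun_sub, fderiv_fun_mul, fderiv_fun_pow, fderiv.fst,
    fderiv.snd, fderiv_fst_apply_coord]
  rw [IsTangent, ← sub_eq_zero]
  refine Eq.congr ?_ rfl
  simp only [cubicVariation, eval_derivative_cubic, eval_sub, eval_add, eval_mul, eval_pow, eval_C,
    eval_X, fderiv_fun_id, fderiv_fun_const, ContinuousLinearMap.comp_id,
    ContinuousLinearMap.comp_apply, ContinuousLinearMap.proj_apply, ContinuousLinearMap.coe_fst',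
    ContinuousLinearMap.coe_snd', Nat.add_one_sub_one, Nat.cast_ofNat, Pi.zero_apply, map_mul,
    add_apply, sub_apply, smul_apply, zero_apply, smul_add, smul_eq_mul, nsmul_eq_mul]
  ring

/-- The Hamiltonian vector field `2 y ∂/∂x + p'(x) ∂/∂y` of the equation `y² = p(x)` of the
curves. -/
def hamiltonianField (z : (Fin 4 → ℂ) × ℂ × ℂ) : ℂ × ℂ :=
  (2 * z.2.2, (derivative (cubic z.1)).eval z.2.1)

theorem hamiltonianField_ne_zero (ht : t ∈ T) (hq : q ∈ E t) : hamiltonianField (t, q) ≠ 0 := by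
  intro h
  obtain ⟨hy, hp'⟩ : q.2 = 0 ∧ (derivative (cubic t)).eval q.1 = 0 := by
    simpa [hamiltonianField] using h
  have hp : (cubic t).eval q.1 = 0 := by rw [← show q.2 ^ 2 = _ from hq, hy]; simp
  rw [eval_cubic] at hp
  rw [eval_derivative_cubic] at hp'
  have h_t2 : t 2 = 12 * t 0 * (q.1 - t 1) ^ 2 := by linear_combination -hp'
  have h_t3 : t 3 = -8 * t 0 * (q.1 - t 1) ^ 3 := by linear_combination -hp - (q.1 - t 1) * h_t2
  refine ht ?_
  rw [disc, h_t2, h_t3]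
  ring

theorem IsTangent.smul_eq_smul_hamiltonianField (hv : IsTangent t q 0 v)
    (ℓ : ℂ × ℂ →L[ℂ] ℂ) : ℓ (hamiltonianField (t, q)) • v = ℓ v • hamiltonianField (t, q) := by
  have hv : 2 * q.2 * v.2 = (derivative (cubic t)).eval q.1 * v.1 := by
    simpa [IsTangent, cubicVariation] using hv
  have h_decomp (w : ℂ × ℂ) : ℓ w = w.1 * ℓ (1, 0) + w.2 * ℓ (0, 1) := by
    rw [← smul_eq_mul, ← smul_eq_mul, ← map_smul, ← map_smul, ← map_add]
    simp
  rw [h_decomp v, h_decomp (hamiltonianField _), hamiltonianField]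
  ext
  · simp only [Prod.smul_fst, smul_eq_mul]
    linear_combination -ℓ (0, 1) * hv
  · simp only [Prod.smul_snd, smul_eq_mul]
    linear_combination ℓ (1, 0) * hv

theorem ω_hamiltonianField (ht : t ∈ T) (hq : q ∈ E t) :
    ω t j q (hamiltonianField (t, q)) = 2 * q.1 ^ (j : ℕ) := by
  by_cases hy : q.2 = 0
  · have hp : (derivative (cubic t)).eval q.1 ≠ 0 := fun hp =>
      hamiltonianField_ne_zero ht hq (by simp [hamiltonianField, hy, hp])
    simp only [ω, dxOverY, hamiltonianField, hy, ne_eq, not_true_eq_false, if_false, smul_apply,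
      ContinuousLinearMap.coe_snd', smul_eq_mul]
    field_simp
  · simp only [ω, dxOverY, hamiltonianField, hy, ne_eq, not_false_eq_true, if_true, smul_apply,
      ContinuousLinearMap.coe_fst', smul_eq_mul]
    field_simp

/-- The horizontal lift of `τ` at the points of the curve `E t`: the vector field whose Lie
derivative acts on the forms `ω_j` as the Gauss–Manin connection, up to exact forms. -/
def horizontalLift (t τ : Fin 4 → ℂ) (q : ℂ × ℂ) : ℂ × ℂ :=
  (-(liftX t τ).eval q.1, -((liftY t τ).eval q.1 * q.2))

theorem isTangent_horizontalLift (ht : t ∈ T) (hq : q ∈ E t) :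
    IsTangent t q τ (horizontalLift t τ q) := by
  have hq : q.2 ^ 2 = (cubic t).eval q.1 := hq
  rw [IsTangent, cubicVariation_eq τ ht]
  simp only [horizontalLift, eval_sub, eval_mul, eval_ofNat]
  linear_combination -2 * (liftY t τ).eval q.1 * hq

theorem differentiableAt_horizontalLift :
    DifferentiableAt ℂ (horizontalLift t τ) q := by
  unfold horizontalLift
  fun_prop

theorem fderiv_horizontalLift_apply :
    fderiv ℂ (horizontalLift t τ) q v = (-((derivative (liftX t τ)).eval q.1 * v.1),
      -((derivative (liftY t τ)).eval q.1 * v.1 * q.2 + (liftY t τ).eval q.1 * v.2)) := by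
  have h (P : ℂ[X]) := (P.hasDerivAt q.1).hasFDerivAt.comp q hasFDerivAt_fst
  have h_lift : HasFDerivAt (horizontalLift t τ) _ q :=
    (h (liftX t τ)).neg.prodMk ((h (liftY t τ)).mul hasFDerivAt_snd).neg
  rw [h_lift.fderiv]
  ext
  · simp [mul_comm]
  · simp only [Function.comp_apply, ContinuousLinearMap.prod_apply, ContinuousLinearMap.comp_apply,
      ContinuousLinearMap.toSpanSingleton_apply, ContinuousLinearMap.coe_fst',
      ContinuousLinearMap.coe_snd', neg_apply, add_apply, smul_apply, smul_eq_mul]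
    ring

theorem contDiff_hamiltonianField {n : WithTop ℕ∞} : ContDiff ℂ n hamiltonianField := by
  unfold hamiltonianField
  simp only [eval_derivative_cubic]
  fun_prop

theorem fderiv_hamiltonianField_apply :
    fderiv ℂ hamiltonianField (t, q) (τ, v) =
      (2 * v.2, (derivative (cubicVariation t τ)).eval q.1 +
        (derivative (derivative (cubic t))).eval q.1 * v.1) := by
  unfold hamiltonianField
  simp only [eval_derivative_cubic]
  rw [DifferentiableAt.fderiv_prodMk (by fun_prop) (by fun_prop)]
  simp (disch := fun_prop) only [fderiv_fun_sub, fderiv_fun_mul, fderiv_fun_pow, fderiv.fst,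
    fderiv.snd, fderiv_fst_apply_coord]
  ext
  · simp
  · simp only [derivative_cubic, cubicVariation, derivative_sub, derivative_add, derivative_mul,
      derivative_pow, derivative_C, derivative_X, eval_sub, eval_add, eval_mul, eval_pow, eval_neg,
      eval_C, eval_X, eval_zero, eval_one, fderiv_fun_id, fderiv_fun_const,
      ContinuousLinearMap.comp_id, ContinuousLinearMap.prod_apply, ContinuousLinearMap.comp_apply,
      ContinuousLinearMap.proj_apply, ContinuousLinearMap.coe_fst', ContinuousLinearMap.coe_snd',
      Nat.add_one_sub_one, Nat.cast_ofNat, Pi.zero_apply, map_mul, add_apply, sub_apply,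
      smul_apply, zero_apply, smul_eq_mul, nsmul_eq_mul, zero_mul, zero_sub, mul_neg]
    ring

/-- As `dx / y` takes the constant value `2` on the Hamiltonian field `H`, this value of minus the
bracket of the lift with `H` amounts to the identity `∇_τ ω_0 = (a_{00} + a_{01} x) dx / y`. -/
theorem fderiv_horizontalLift_sub_fderiv_hamiltonianField (ht : t ∈ T) (hq : q ∈ E t) :
    fderiv ℂ (horizontalLift t τ) q (hamiltonianField (t, q)) -
        fderiv ℂ hamiltonianField (t, q) (τ, horizontalLift t τ q) =
      (connPoly t τ 0).eval q.1 • hamiltonianField (t, q) := by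
  have hq : q.2 ^ 2 = (cubic t).eval q.1 := hq
  rw [fderiv_horizontalLift_apply, fderiv_hamiltonianField_apply, cubicVariation_eq τ ht]
  ext
  · simp only [hamiltonianField, horizontalLift, liftY, Prod.fst_sub, Prod.smul_fst, eval_add,
      smul_eq_mul]
    ring
  · have hW : (liftY t τ).eval q.1 =
        (connPoly t τ 0).eval q.1 + (derivative (liftX t τ)).eval q.1 := by
      rw [liftY, eval_add]
    simp only [hamiltonianField, horizontalLift, Prod.snd_sub, Prod.smul_snd, derivative_sub,
      derivative_mul, derivative_ofNat, eval_add, eval_sub, eval_mul, eval_ofNat, eval_zero,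
      smul_eq_mul]
    linear_combination -2 * (derivative (liftY t τ)).eval q.1 * hq +
      (derivative (cubic t)).eval q.1 * hW

/-- The coefficient `f` in `ω_j = f dℓ` on the curves, for `ℓ` a linear function. -/
def formCoeff (ℓ : ℂ × ℂ →L[ℂ] ℂ) (j : Fin 2) (z : (Fin 4 → ℂ) × ℂ × ℂ) : ℂ :=
  2 * z.2.1 ^ (j : ℕ) / ℓ (hamiltonianField z)

variable {ℓ : ℂ × ℂ →L[ℂ] ℂ}

theorem eventually_apply_hamiltonianField_ne_zero {z : (Fin 4 → ℂ) × ℂ × ℂ}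
    (hℓ : ℓ (hamiltonianField z) ≠ 0) : ∀ᶠ w in 𝓝 z, ℓ (hamiltonianField w) ≠ 0 :=
  (ℓ.continuous.comp (contDiff_hamiltonianField (n := 1)).continuous).continuousAt.eventually_ne hℓ

theorem ω_eq_formCoeff_mul (ht : t ∈ T) (hq : q ∈ E t) (hℓ : ℓ (hamiltonianField (t, q)) ≠ 0)
    (hv : IsTangent t q 0 v) : ω t j q v = formCoeff ℓ j (t, q) * ℓ v := by
  have h := congrArg (ω t j q) (hv.smul_eq_smul_hamiltonianField ℓ)
  rw [map_smul, map_smul, ω_hamiltonianField ht hq, smul_eq_mul, smul_eq_mul] at h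
  rw [formCoeff, div_mul_eq_mul_div, eq_div_iff hℓ]
  linear_combination h

theorem contDiffAt_formCoeff {n : WithTop ℕ∞} {z : (Fin 4 → ℂ) × ℂ × ℂ}
    (hℓ : ℓ (hamiltonianField z) ≠ 0) : ContDiffAt ℂ n (formCoeff ℓ j) z :=
  ContDiffAt.div (by fun_prop) (ℓ.contDiff.contDiffAt.comp z contDiff_hamiltonianField.contDiffAt)
    hℓ

theorem fderiv_formCoeff_mul {z : (Fin 4 → ℂ) × ℂ × ℂ} (hℓ : ℓ (hamiltonianField z) ≠ 0) :
    fderiv ℂ (formCoeff ℓ j) z (τ, v) * ℓ (hamiltonianField z) +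
        formCoeff ℓ j z * ℓ (fderiv ℂ hamiltonianField z (τ, v)) =
      2 * (derivative (X ^ (j : ℕ))).eval z.2.1 * v.1 := by
  have h_den : HasFDerivAt (fun z => ℓ (hamiltonianField z)) _ z := ℓ.hasFDerivAt.comp z
    (contDiff_hamiltonianField.differentiable one_ne_zero z).hasFDerivAt
  have h_prod := ((contDiffAt_formCoeff (j := j) hℓ).differentiableAt one_ne_zero).hasFDerivAt.mul
    h_den
  have h_num : HasFDerivAt (fun z : (Fin 4 → ℂ) × ℂ × ℂ => 2 * z.2.1 ^ (j : ℕ)) _ z :=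
    ((hasFDerivAt_snd (𝕜 := ℂ) (p := z)).fst.pow (j : ℕ)).const_mul 2
  have h := h_prod.unique (h_num.congr_of_eventuallyEq ?_)
  · have h_apply := congrArg (fun f' => f' (τ, v)) h
    simp only [derivative_X_pow, eval_mul, eval_pow, eval_X, eval_C, add_apply, smul_apply,
      ContinuousLinearMap.comp_apply, ContinuousLinearMap.coe_fst', ContinuousLinearMap.coe_snd',
      smul_eq_mul, nsmul_eq_mul] at h_apply ⊢
    linear_combination h_apply
  · filter_upwards [h_den.continuousAt.eventually_ne hℓ] with w hw
    exact div_mul_cancel₀ _ hw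

theorem connA_apply : connA t j k τ = connMatrix t τ j k := by
  simp only [connA, connMatrix, Matrix.of_apply, Matrix.sum_apply, Matrix.smul_apply, smul_apply,
    sum_apply, ContinuousLinearMap.proj_apply, smul_eq_mul, Finset.mul_sum]
  refine Finset.sum_congr rfl fun i _ => ?_
  ring

theorem sum_connA_mul_formCoeff :
    ∑ k, connA t j k τ * formCoeff ℓ k (t, q) =
      2 * (connPoly t τ j).eval q.1 / ℓ (hamiltonianField (t, q)) := by
  simp only [Fin.sum_univ_two, connA_apply, formCoeff, connPoly, eval_add, eval_mul, eval_C, eval_X,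
    Fin.val_zero, Fin.val_one, pow_zero, pow_one]
  ring

theorem fderiv_formCoeff_horizontalLift (ht : t ∈ T) (hq : q ∈ E t)
    (hℓ : ℓ (hamiltonianField (t, q)) ≠ 0)
    (hw : ℓ (hamiltonianField (t, q)) • v = hamiltonianField (t, q)) :
    fderiv ℂ (formCoeff ℓ j) (t, q) (τ, horizontalLift t τ q) +
        formCoeff ℓ j (t, q) * ℓ (fderiv ℂ (horizontalLift t τ) q v) =
      ∑ k, connA t j k τ * formCoeff ℓ k (t, q) + j * exactCoeff t τ * v.2 := by
  have h_w : ℓ (hamiltonianField (t, q)) * ℓ (fderiv ℂ (horizontalLift t τ) q v) =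
      ℓ (fderiv ℂ (horizontalLift t τ) q (hamiltonianField (t, q))) := by
    conv_rhs => rw [← hw, map_smul, map_smul, smul_eq_mul]
  have h_w₂ : ℓ (hamiltonianField (t, q)) * v.2 = (derivative (cubic t)).eval q.1 :=
    congrArg Prod.snd hw
  have h_bracket := congrArg ℓ
    (fderiv_horizontalLift_sub_fderiv_hamiltonianField (τ := τ) ht hq)
  rw [map_sub, map_smul, smul_eq_mul] at h_bracket
  have h_poly := congrArg (eval q.1) (X_pow_mul_connPoly_zero τ ht j)
  simp only [eval_sub, eval_add, eval_mul, eval_pow, eval_X, eval_C] at h_poly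
  have h_deriv := fderiv_formCoeff_mul (j := j) (τ := τ) (v := horizontalLift t τ q) hℓ
  have h_coeff : formCoeff ℓ j (t, q) * ℓ (hamiltonianField (t, q)) = 2 * q.1 ^ (j : ℕ) :=
    div_mul_cancel₀ _ hℓ
  have h_lift₁ : (horizontalLift t τ q).1 = -(liftX t τ).eval q.1 := rfl
  rw [sum_connA_mul_formCoeff, div_add' _ _ _ hℓ, eq_div_iff hℓ]
  linear_combination h_deriv + formCoeff ℓ j (t, q) * (h_w + h_bracket) + 2 * h_poly +
    (connPoly t τ 0).eval q.1 * h_coeff - j * exactCoeff t τ * h_w₂ +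
    2 * (derivative (X ^ (j : ℕ))).eval q.1 * h_lift₁

end TotalSpace

section Chart

/-- A holomorphic parametrization `Ψ` of the curves `E t` near `q₀`, for `t` near `t₀`, by the
linear function `ℓ`. -/
structure Chart (t₀ : Fin 4 → ℂ) (q₀ : ℂ × ℂ) (ℓ : ℂ × ℂ →L[ℂ] ℂ)
    (Ψ : (Fin 4 → ℂ) × ℂ → ℂ × ℂ) : Prop where
  contDiffAt : ContDiffAt ℂ 2 Ψ (t₀, ℓ q₀)
  base : Ψ (t₀, ℓ q₀) = q₀
  mem : ∀ᶠ z in 𝓝 (t₀, ℓ q₀), Ψ z ∈ E z.1 ∧ ℓ (Ψ z) = z.2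
  inv : ∀ᶠ z in 𝓝 (t₀, q₀), z.2 ∈ E z.1 → Ψ (z.1, ℓ z.2) = z.2

variable {t t₀ τ τ' : Fin 4 → ℂ} {q q₀ v w : ℂ × ℂ} {ℓ : ℂ × ℂ →L[ℂ] ℂ}
  {Ψ : (Fin 4 → ℂ) × ℂ → ℂ × ℂ}

theorem IsTangent.sub (hv : IsTangent t q τ v) (hw : IsTangent t q τ' w) :
    IsTangent t q (τ - τ') (v - w) := by
  rw [isTangent_iff] at hv hw ⊢
  rw [← Prod.mk_sub_mk, map_sub, hv, hw, sub_zero]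

theorem IsTangent.eq_of_apply_eq (hℓ : ℓ (hamiltonianField (t, q)) ≠ 0) (hv : IsTangent t q τ v)
    (hw : IsTangent t q τ w) (h : ℓ v = ℓ w) : v = w := by
  have h_sub := (sub_self τ ▸ hv.sub hw).smul_eq_smul_hamiltonianField ℓ
  rw [map_sub, h, sub_self, zero_smul, smul_eq_zero] at h_sub
  exact sub_eq_zero.1 (h_sub.resolve_left hℓ)

/-- The change of coordinates that replaces `(x, y)` by the equation of the curves and the linear
function `ℓ`. -/
def straighten (ℓ : ℂ × ℂ →L[ℂ] ℂ) (z : (Fin 4 → ℂ) × ℂ × ℂ) : (Fin 4 → ℂ) × ℂ × ℂ :=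
  (z.1, curveEq z, ℓ z.2)

theorem contDiff_straighten {n : WithTop ℕ∞} : ContDiff ℂ n (straighten ℓ) :=
  contDiff_fst.prodMk (contDiff_curveEq.prodMk (ℓ.contDiff.comp contDiff_snd))

theorem exists_hasFDerivAt_straighten (hℓ : ℓ (hamiltonianField (t, q)) ≠ 0) :
    ∃ Φ' : ((Fin 4 → ℂ) × ℂ × ℂ) ≃L[ℂ] (Fin 4 → ℂ) × ℂ × ℂ,
      HasFDerivAt (straighten ℓ) (Φ' : _ →L[ℂ] _) (t, q) := by
  set Φ' := (ContinuousLinearMap.fst ℂ (Fin 4 → ℂ) (ℂ × ℂ)).prod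
    ((fderiv ℂ curveEq (t, q)).prod (ℓ.comp (ContinuousLinearMap.snd ℂ _ _)))
  have h_inj : Function.Injective (Φ' : (Fin 4 → ℂ) × ℂ × ℂ →ₗ[ℂ] (Fin 4 → ℂ) × ℂ × ℂ) := by
    refine (injective_iff_map_eq_zero _).2 ?_
    rintro ⟨τ, v⟩ h
    obtain ⟨rfl, hv, hℓv⟩ : τ = 0 ∧ fderiv ℂ curveEq (t, q) (τ, v) = 0 ∧ ℓ v = 0 := by
      simpa [Φ'] using h
    have h_zero : IsTangent t q 0 0 := isTangent_iff.2 (map_zero _)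
    rw [(isTangent_iff.2 hv).eq_of_apply_eq hℓ h_zero (hℓv.trans (map_zero ℓ).symm),
      Prod.mk_zero_zero]
  refine ⟨(LinearEquiv.ofInjectiveEndo _ h_inj).toContinuousLinearEquiv, ?_⟩
  refine (hasFDerivAt_fst.prodMk ((contDiff_curveEq.differentiable one_ne_zero _).hasFDerivAt.prodMk
    (ℓ.hasFDerivAt.comp _ hasFDerivAt_snd))).congr_fderiv ?_
  ext <;> rfl

theorem exists_chart (hq : q₀ ∈ E t₀) (hℓ : ℓ (hamiltonianField (t₀, q₀)) ≠ 0) :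
    ∃ Ψ, Chart t₀ q₀ ℓ Ψ := by
  obtain ⟨Φ', hΦ'⟩ := exists_hasFDerivAt_straighten hℓ
  have hΦ := (contDiff_straighten (ℓ := ℓ) (n := 2)).contDiffAt (x := (t₀, q₀))
  have hΦ_strict := hΦ.hasStrictFDerivAt' hΦ' two_ne_zero
  have h_base : straighten ℓ (t₀, q₀) = (t₀, 0, ℓ q₀) := by
    rw [straighten, mem_E_iff.1 hq]
  set Φinv := hΦ.localInverse hΦ' two_ne_zero
  have h_slice : Filter.Tendsto (fun z : (Fin 4 → ℂ) × ℂ => (z.1, (0 : ℂ), z.2)) (𝓝 (t₀, ℓ q₀))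
      (𝓝 (straighten ℓ (t₀, q₀))) := by
    rw [h_base]
    exact Continuous.tendsto (by fun_prop) (t₀, ℓ q₀)
  refine ⟨fun z => (Φinv (z.1, 0, z.2)).2, ?_, ?_, ?_, ?_⟩
  · exact contDiffAt_snd.comp _
      (ContDiffAt.comp _ (h_base ▸ hΦ.to_localInverse hΦ' two_ne_zero) (by fun_prop))
  · simp only [← h_base, Φinv, hΦ.localInverse_apply_image hΦ' two_ne_zero]
  · filter_upwards [h_slice.eventually hΦ_strict.eventually_right_inverse] with z hz
    replace hz : straighten ℓ (Φinv (z.1, 0, z.2)) = (z.1, 0, z.2) := hz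
    obtain ⟨h_fst, h_curveEq, hℓz⟩ := by simpa only [straighten, Prod.mk.injEq] using hz
    exact ⟨mem_E_iff.2 ((congrArg (fun s => curveEq (s, _)) h_fst.symm).trans h_curveEq), hℓz⟩
  · filter_upwards [hΦ_strict.eventually_left_inverse] with z hz hzE
    rw [← mem_E_iff.1 hzE]
    exact congrArg Prod.snd hz

namespace Chart

theorem tendsto (hc : Chart t₀ q₀ ℓ Ψ) :
    Filter.Tendsto (fun z => (z.1, Ψ z)) (𝓝 (t₀, ℓ q₀)) (𝓝 (t₀, q₀)) := by
  have h := (continuousAt_fst (p := (t₀, ℓ q₀))).prodMk hc.contDiffAt.continuousAt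
  simpa only [ContinuousAt, hc.base] using h

theorem eventually_isTangent (hc : Chart t₀ q₀ ℓ Ψ) :
    ∀ᶠ z in 𝓝 (t₀, ℓ q₀), ∀ τ ν, IsTangent z.1 (Ψ z) τ (fderiv ℂ Ψ z (τ, ν)) ∧
      ℓ (fderiv ℂ Ψ z (τ, ν)) = ν := by
  filter_upwards [hc.contDiffAt.eventually (by simp), hc.mem.eventually_nhds] with z hz hmem
  have hd : HasFDerivAt Ψ (fderiv ℂ Ψ z) z := (hz.differentiableAt two_ne_zero).hasFDerivAt
  refine fun τ ν => ⟨?_, ?_⟩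
  · have h_chain := HasFDerivAt.comp (g := curveEq) z
      (contDiff_curveEq.differentiable one_ne_zero (z.1, Ψ z)).hasFDerivAt
      ((hasFDerivAt_fst (𝕜 := ℂ) (p := z)).prodMk hd)
    have h_zero : HasFDerivAt (fun w => curveEq (w.1, Ψ w)) (0 : (Fin 4 → ℂ) × ℂ →L[ℂ] ℂ) z :=
      (hasFDerivAt_const (0 : ℂ) z).congr_of_eventuallyEq
        (hmem.mono fun w hw => mem_E_iff.1 hw.1)
    have h_apply := congrArg (fun L => L (τ, ν)) (h_chain.unique h_zero)
    exact isTangent_iff.2 (by simpa using h_apply)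
  · have h_comp : HasFDerivAt (fun w => ℓ (Ψ w)) _ z := ℓ.hasFDerivAt.comp z hd
    have h_snd : HasFDerivAt (fun w => ℓ (Ψ w)) _ z :=
      (hasFDerivAt_snd (𝕜 := ℂ) (p := z)).congr_of_eventuallyEq (hmem.mono fun w hw => hw.2)
    simpa using congrArg (fun L => L (τ, ν)) (h_comp.unique h_snd)

end Chart

end Chart

section Defect

variable {t₀ : Fin 4 → ℂ} {q₀ : ℂ × ℂ} {ℓ : ℂ × ℂ →L[ℂ] ℂ} {Ψ : (Fin 4 → ℂ) × ℂ → ℂ × ℂ}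
  {P : Fin 2 → (Fin 4 → ℂ) × ℂ → ℂ}

/-- The coefficient `f` in `ω_j = f du` on the curves, for `u` the coordinate of the chart `Ψ`. -/
def chartCoeff (ℓ : ℂ × ℂ →L[ℂ] ℂ) (Ψ : (Fin 4 → ℂ) × ℂ → ℂ × ℂ) (j : Fin 2)
    (z : (Fin 4 → ℂ) × ℂ) : ℂ :=
  formCoeff ℓ j (z.1, Ψ z)

namespace Chart

theorem contDiffAt_chartCoeff (hc : Chart t₀ q₀ ℓ Ψ) (hℓ : ℓ (hamiltonianField (t₀, q₀)) ≠ 0)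
    (j : Fin 2) : ContDiffAt ℂ 2 (chartCoeff ℓ Ψ j) (t₀, ℓ q₀) := by
  refine ContDiffAt.comp (t₀, ℓ q₀) ?_ (contDiffAt_fst.prodMk hc.contDiffAt)
  rw [hc.base]
  exact contDiffAt_formCoeff hℓ

theorem eventually_fderiv_chartCoeff (hc : Chart t₀ q₀ ℓ Ψ) (ht : t₀ ∈ T)
    (hℓ : ℓ (hamiltonianField (t₀, q₀)) ≠ 0) :
    ∀ᶠ z in 𝓝 (t₀, ℓ q₀), ∀ j τ,
      fderiv ℂ (chartCoeff ℓ Ψ j) z (τ, ℓ (horizontalLift z.1 τ (Ψ z))) + chartCoeff ℓ Ψ j z *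
          ℓ (fderiv ℂ (horizontalLift z.1 τ) (Ψ z) (fderiv ℂ Ψ z (0, 1))) =
        ∑ k, connA z.1 j k τ * chartCoeff ℓ Ψ k z +
          j * exactCoeff z.1 τ * (fderiv ℂ Ψ z (0, 1)).2 := by
  filter_upwards [hc.eventually_isTangent, hc.mem, continuousAt_fst.eventually_mem
    (isOpen_T.mem_nhds ht), hc.tendsto.eventually (eventually_apply_hamiltonianField_ne_zero hℓ),
    hc.contDiffAt.eventually (by simp)] with z h_tangent hz hzT hzℓ hΨ j τ
  have h_lift : fderiv ℂ Ψ z (τ, ℓ (horizontalLift z.1 τ (Ψ z))) = horizontalLift z.1 τ (Ψ z) :=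
    (h_tangent _ _).1.eq_of_apply_eq hzℓ (isTangent_horizontalLift hzT hz.1) (h_tangent _ _).2
  have h_vertical : ℓ (hamiltonianField (z.1, Ψ z)) • fderiv ℂ Ψ z (0, 1) =
      hamiltonianField (z.1, Ψ z) := by
    rw [(h_tangent 0 1).1.smul_eq_smul_hamiltonianField, (h_tangent 0 1).2, one_smul]
  have h_chain : HasFDerivAt (chartCoeff ℓ Ψ j) _ z := HasFDerivAt.comp (g := formCoeff ℓ j) z
    ((contDiffAt_formCoeff hzℓ).differentiableAt one_ne_zero).hasFDerivAt
    (hasFDerivAt_fst.prodMk (hΨ.differentiableAt two_ne_zero).hasFDerivAt)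
  rw [h_chain.fderiv, ContinuousLinearMap.comp_apply, ContinuousLinearMap.prod_apply, h_lift]
  exact fderiv_formCoeff_horizontalLift hzT hz.1 hzℓ h_vertical

end Chart

/-- The failure of the primitives `P j` of the forms `ω_j` to satisfy the Gauss–Manin equation
along the horizontal lift of `τ`. -/
def defect (t : Fin 4 → ℂ) (ℓ : ℂ × ℂ →L[ℂ] ℂ) (Ψ : (Fin 4 → ℂ) × ℂ → ℂ × ℂ)
    (P : Fin 2 → (Fin 4 → ℂ) × ℂ → ℂ) (j : Fin 2) (τ : Fin 4 → ℂ) (u : ℂ) : ℂ :=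
  fderiv ℂ (P j) (t, u) (τ, ℓ (horizontalLift t τ (Ψ (t, u)))) -
    (∑ k, connA t j k τ * P k (t, u) + j * exactCoeff t τ * (Ψ (t, u)).2)

namespace Chart

theorem eventually_hasDerivAt_defect (hc : Chart t₀ q₀ ℓ Ψ) (ht : t₀ ∈ T)
    (hℓ : ℓ (hamiltonianField (t₀, q₀)) ≠ 0)
    (hP : ∀ j, ∀ᶠ z in 𝓝 (t₀, ℓ q₀), IsParametricPrimitiveAt (P j) (chartCoeff ℓ Ψ j) z) :
    ∀ᶠ u in 𝓝 (ℓ q₀), ∀ j τ, HasDerivAt (defect t₀ ℓ Ψ P j τ) 0 u := by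
  have h_slice : Filter.Tendsto (fun u => (t₀, u)) (𝓝 (ℓ q₀)) (𝓝 (t₀, ℓ q₀)) :=
    Continuous.tendsto (by fun_prop) _
  filter_upwards [h_slice.eventually (Filter.eventually_all.2 hP).eventually_nhds,
    h_slice.eventually (hc.eventually_fderiv_chartCoeff ht hℓ),
    h_slice.eventually (hc.contDiffAt.eventually (by simp)),
    h_slice.eventually (Filter.eventually_all.2 fun j =>
      (hc.contDiffAt_chartCoeff hℓ j).eventually (by simp))] with u hPu h_conn hΨ h_coeff j τ
  have hPu_slice : ∀ᶠ v in 𝓝 u, ∀ j, IsParametricPrimitiveAt (P j) (chartCoeff ℓ Ψ j) (t₀, v) :=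
    (Continuous.tendsto (by fun_prop) u).eventually hPu
  have h_primitive (k : Fin 2) : HasDerivAt (fun v => P k (t₀, v)) (chartCoeff ℓ Ψ k (t₀, u)) u :=
    (hPu.self_of_nhds k).fderiv_vertical ▸ hasDerivAt_slice (hPu.self_of_nhds k).differentiableAt
  have h_chart := hasDerivAt_slice (hΨ.differentiableAt two_ne_zero)
  have h_chart_snd := hasFDerivAt_snd.comp_hasDerivAt u h_chart
  have h_lift := ℓ.hasFDerivAt.comp_hasDerivAt u
    (differentiableAt_horizontalLift.hasFDerivAt.comp_hasDerivAt u h_chart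
      (l := horizontalLift t₀ τ))
  have h_coeff := hasDerivAt_slice ((h_coeff j).differentiableAt two_ne_zero)
  have h_sum : HasDerivAt (fun v => ∑ k, connA t₀ j k τ * P k (t₀, v))
      (∑ k, connA t₀ j k τ * chartCoeff ℓ Ψ k (t₀, u)) u :=
    HasDerivAt.fun_sum fun k _ => (h_primitive k).const_mul _
  have h := (((hPu.self_of_nhds j).hasDerivAt_fderiv τ).add (h_lift.mul h_coeff)).sub
    (h_sum.add (h_chart_snd.const_mul (j * exactCoeff t₀ τ)))
  refine (h.congr_deriv ?_).congr_of_eventuallyEq ?_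
  · have h_conn := h_conn j τ
    rw [clm_apply_prodMk] at h_conn
    simp only [Function.comp_apply, ContinuousLinearMap.coe_snd']
    linear_combination h_conn
  · filter_upwards [hPu_slice] with v hv
    rw [defect, clm_apply_prodMk, (hv j).fderiv_vertical]
    rfl

theorem eventually_defect_eq (hc : Chart t₀ q₀ ℓ Ψ) (ht : t₀ ∈ T)
    (hℓ : ℓ (hamiltonianField (t₀, q₀)) ≠ 0)
    (hP : ∀ j, ∀ᶠ z in 𝓝 (t₀, ℓ q₀), IsParametricPrimitiveAt (P j) (chartCoeff ℓ Ψ j) z) :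
    ∀ᶠ u in 𝓝 (ℓ q₀), ∀ j τ, defect t₀ ℓ Ψ P j τ u = defect t₀ ℓ Ψ P j τ (ℓ q₀) := by
  obtain ⟨r, hr, h⟩ := Metric.eventually_nhds_iff_ball.1
    (hc.eventually_hasDerivAt_defect ht hℓ hP)
  filter_upwards [Metric.ball_mem_nhds _ hr] with u hu j τ
  exact Metric.isOpen_ball.is_const_of_deriv_eq_zero (convex_ball _ _).isPreconnected
    (fun v hv => (h v hv j τ).differentiableAt.differentiableWithinAt)
    (fun v hv => (h v hv j τ).deriv) hu (Metric.mem_ball_self hr)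

end Chart

end Defect

section LocalPeriod

variable {t₀ : Fin 4 → ℂ} {q₀ : ℂ × ℂ} {ℓ : ℂ × ℂ →L[ℂ] ℂ} {Ψ : (Fin 4 → ℂ) × ℂ → ℂ × ℂ}
  {P : Fin 2 → (Fin 4 → ℂ) × ℂ → ℂ}

/-- Primitives `F j`, near the point `q₀` of `E t₀`, of the forms `ω_j` along the curves `E t`,
which satisfy the Gauss–Manin equation, with the exact term `d(j c y)` integrated, along the
horizontal lifts of the coordinate directions at `t₀`. -/
structure LocalPeriod (t₀ : Fin 4 → ℂ) (q₀ : ℂ × ℂ) (F : Fin 2 → (Fin 4 → ℂ) × ℂ × ℂ → ℂ) :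
    Prop where
  differentiableAt : ∀ᶠ z in 𝓝 (t₀, q₀), ∀ j, DifferentiableAt ℂ (F j) z
  vertical : ∀ᶠ z in 𝓝 (t₀, q₀), z.2 ∈ E z.1 → ∀ j v, IsTangent z.1 z.2 0 v →
    fderiv ℂ (F j) z (0, v) = ω z.1 j z.2 v
  horizontal : ∀ᶠ q in 𝓝 q₀, q ∈ E t₀ → ∀ j i,
    fderiv ℂ (F j) (t₀, q) (Pi.single i 1, horizontalLift t₀ (Pi.single i 1) q) =
      ∑ k, connA t₀ j k (Pi.single i 1) * F k (t₀, q) + j * exactCoeff t₀ (Pi.single i 1) * q.2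

/-- The primitives `P j`, as functions on the total space, corrected by a function of the parameters
so as to remove their defect at `(t₀, u₀)`. -/
def correctedPrimitive (t₀ : Fin 4 → ℂ) (u₀ : ℂ) (ℓ : ℂ × ℂ →L[ℂ] ℂ)
    (Ψ : (Fin 4 → ℂ) × ℂ → ℂ × ℂ) (P : Fin 2 → (Fin 4 → ℂ) × ℂ → ℂ) (j : Fin 2)
    (z : (Fin 4 → ℂ) × ℂ × ℂ) : ℂ :=
  P j (z.1, ℓ z.2) - ∑ i, defect t₀ ℓ Ψ P j (Pi.single i 1) u₀ * (z.1 i - t₀ i)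

theorem hasFDerivAt_correctedPrimitive {u₀ : ℂ} {j : Fin 2} {z : (Fin 4 → ℂ) × ℂ × ℂ}
    (hP : DifferentiableAt ℂ (P j) (z.1, ℓ z.2)) :
    ∃ F' : (Fin 4 → ℂ) × ℂ × ℂ →L[ℂ] ℂ, HasFDerivAt (correctedPrimitive t₀ u₀ ℓ Ψ P j) F' z ∧
      ∀ τ v, F' (τ, v) = fderiv ℂ (P j) (z.1, ℓ z.2) (τ, ℓ v) -
        ∑ i, defect t₀ ℓ Ψ P j (Pi.single i 1) u₀ * τ i := by
  have h_coord (i : Fin 4) :=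
    ((ContinuousLinearMap.proj (R := ℂ) (φ := fun _ : Fin 4 => ℂ) i).hasFDerivAt.comp z
      hasFDerivAt_fst).sub_const (t₀ i) |>.const_mul (defect t₀ ℓ Ψ P j (Pi.single i 1) u₀)
  have h_straight : HasFDerivAt (fun z : (Fin 4 → ℂ) × ℂ × ℂ => (z.1, ℓ z.2)) _ z :=
    hasFDerivAt_fst.prodMk (ℓ.hasFDerivAt.comp z hasFDerivAt_snd)
  exact ⟨_, (hP.hasFDerivAt.comp z h_straight).sub (HasFDerivAt.fun_sum fun i _ => h_coord i),
    fun τ v => by simp⟩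

theorem Chart.localPeriod (hc : Chart t₀ q₀ ℓ Ψ) (ht : t₀ ∈ T)
    (hℓ : ℓ (hamiltonianField (t₀, q₀)) ≠ 0)
    (hP : ∀ j, ∀ᶠ z in 𝓝 (t₀, ℓ q₀), IsParametricPrimitiveAt (P j) (chartCoeff ℓ Ψ j) z) :
    LocalPeriod t₀ q₀ (correctedPrimitive t₀ (ℓ q₀) ℓ Ψ P) := by
  have h_coord : Filter.Tendsto (fun z : (Fin 4 → ℂ) × ℂ × ℂ => (z.1, ℓ z.2)) (𝓝 (t₀, q₀))
      (𝓝 (t₀, ℓ q₀)) := Continuous.tendsto (by fun_prop) (t₀, q₀)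
  have h_slice : Filter.Tendsto (fun q : ℂ × ℂ => (t₀, q)) (𝓝 q₀) (𝓝 (t₀, q₀)) :=
    Continuous.tendsto (by fun_prop) q₀
  have h_prim := h_coord.eventually (Filter.eventually_all.2 hP)
  refine ⟨?_, ?_, ?_⟩
  · filter_upwards [h_prim] with z hPz j
    obtain ⟨F', hF', -⟩ := hasFDerivAt_correctedPrimitive (hPz j).differentiableAt
    exact hF'.differentiableAt
  · filter_upwards [h_prim, hc.inv, continuousAt_fst.eventually_mem (isOpen_T.mem_nhds ht),
      eventually_apply_hamiltonianField_ne_zero hℓ] with z hPz h_inv hzT hzℓ hzE j v hv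
    obtain ⟨F', hF', h_apply⟩ := hasFDerivAt_correctedPrimitive (hPz j).differentiableAt
    rw [hF'.fderiv, h_apply, clm_apply_prodMk, (hPz j).fderiv_vertical, chartCoeff, h_inv hzE,
      ω_eq_formCoeff_mul hzT hzE hzℓ hv]
    simp [Prod.mk_zero_zero, mul_comm]
  · filter_upwards [h_slice.eventually h_prim, h_slice.eventually hc.inv,
      (ℓ.continuous.tendsto q₀).eventually (hc.eventually_defect_eq ht hℓ hP)]
      with q hPq h_inv h_defect hqE j i
    obtain ⟨F', hF', h_apply⟩ :=
      hasFDerivAt_correctedPrimitive (z := (t₀, q)) (hPq j).differentiableAt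
    have h_defect := h_defect j (Pi.single i 1)
    rw [defect, h_inv hqE] at h_defect
    rw [hF'.fderiv, h_apply]
    have h_value (k : Fin 2) : correctedPrimitive t₀ (ℓ q₀) ℓ Ψ P k (t₀, q) = P k (t₀, ℓ q) := by
      simp [correctedPrimitive]
    have h_single : ∑ i', defect t₀ ℓ Ψ P j (Pi.single i' 1) (ℓ q₀) *
        (Pi.single i 1 : Fin 4 → ℂ) i' = defect t₀ ℓ Ψ P j (Pi.single i 1) (ℓ q₀) := by
      simp [Pi.single_apply]
    simp only [h_value, h_single]
    linear_combination h_defect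

theorem exists_localPeriod (ht : t₀ ∈ T) (hq₀ : q₀ ∈ E t₀) : ∃ F, LocalPeriod t₀ q₀ F := by
  obtain ⟨ℓ, hℓ⟩ := SeparatingDual.exists_ne_zero (R := ℂ) (hamiltonianField_ne_zero ht hq₀)
  obtain ⟨Ψ, hc⟩ := exists_chart hq₀ hℓ
  choose P hP using fun j => exists_isParametricPrimitiveAt (hc.contDiffAt_chartCoeff hℓ j)
  exact ⟨_, hc.localPeriod ht hℓ hP⟩

/-- The functions `c j` of the parameters satisfy the Gauss–Manin equation at `t₀`. -/
def IsHorizontalAt (c : Fin 2 → (Fin 4 → ℂ) → ℂ) (t₀ : Fin 4 → ℂ) : Prop :=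
  ∀ j, HasFDerivAt (c j) (∑ k, c k t₀ • connA t₀ j k) t₀

namespace IsHorizontalAt

variable {c c' : Fin 2 → (Fin 4 → ℂ) → ℂ}

theorem add (hc : IsHorizontalAt c t₀) (hc' : IsHorizontalAt c' t₀) :
    IsHorizontalAt (c + c') t₀ := fun j =>
  ((hc j).add (hc' j)).congr_fderiv <| by
    ext τ
    simp only [Fin.sum_univ_two, add_apply, smul_apply, smul_eq_mul, Pi.add_apply]
    ring

theorem neg (hc : IsHorizontalAt c t₀) : IsHorizontalAt (-c) t₀ := fun j =>
  (hc j).neg.congr_fderiv <| by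
    ext τ
    simp [add_comm]

theorem congr_of_eventuallyEq (hc : IsHorizontalAt c t₀) (h : ∀ᶠ t in 𝓝 t₀, ∀ j, c' j t = c j t) :
    IsHorizontalAt c' t₀ := fun j => by
  simp only [h.self_of_nhds]
  exact (hc j).congr_of_eventuallyEq (h.mono fun t ht => ht j)

end IsHorizontalAt

namespace LocalPeriod

variable {F F₁ F₂ : Fin 2 → (Fin 4 → ℂ) × ℂ × ℂ → ℂ}

theorem eventually (hF : LocalPeriod t₀ q₀ F) : ∀ᶠ q in 𝓝 q₀, LocalPeriod t₀ q F := by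
  have h_slice : Filter.Tendsto (fun q : ℂ × ℂ => (t₀, q)) (𝓝 q₀) (𝓝 (t₀, q₀)) :=
    Continuous.tendsto (by fun_prop) q₀
  filter_upwards [h_slice.eventually hF.differentiableAt.eventually_nhds,
    h_slice.eventually hF.vertical.eventually_nhds, hF.horizontal.eventually_nhds]
    with q h_diff h_vert h_hor using ⟨h_diff, h_vert, h_hor⟩

theorem isHorizontalAt_sub_comp (h₁ : LocalPeriod t₀ q₀ F₁) (h₂ : LocalPeriod t₀ q₀ F₂)
    (ht : t₀ ∈ T) (hq₀ : q₀ ∈ E t₀) {σ : (Fin 4 → ℂ) → ℂ × ℂ} {σ' : (Fin 4 → ℂ) →L[ℂ] ℂ × ℂ}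
    (hσ : HasFDerivAt σ σ' t₀) (hσ₀ : σ t₀ = q₀) (h_tangent : ∀ τ, IsTangent t₀ q₀ τ (σ' τ)) :
    IsHorizontalAt (fun j t => F₁ j (t, σ t) - F₂ j (t, σ t)) t₀ := by
  intro j
  subst hσ₀
  have h_section := (hasFDerivAt_id t₀).prodMk hσ
  refine (((h₁.differentiableAt.self_of_nhds j).hasFDerivAt.comp t₀ h_section).sub
    ((h₂.differentiableAt.self_of_nhds j).hasFDerivAt.comp t₀ h_section)).congr_fderiv ?_
  refine ContinuousLinearMap.coe_injective (LinearMap.pi_ext' fun i => LinearMap.ext_ring ?_)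
  set τ : Fin 4 → ℂ := Pi.single i 1
  have h_vertical : IsTangent t₀ (σ t₀) 0 (σ' τ - horizontalLift t₀ τ (σ t₀)) :=
    sub_self τ ▸ (h_tangent τ).sub (isTangent_horizontalLift ht hq₀)
  have h_split : (τ, σ' τ) = (τ, horizontalLift t₀ τ (σ t₀)) +
      (0, σ' τ - horizontalLift t₀ τ (σ t₀)) := by simp
  have h_apply {F} (h : LocalPeriod t₀ (σ t₀) F) : fderiv ℂ (F j) (t₀, σ t₀) (τ, σ' τ) =
      ∑ k, connA t₀ j k τ * F k (t₀, σ t₀) + j * exactCoeff t₀ τ * (σ t₀).2 +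
        ω t₀ j (σ t₀) (σ' τ - horizontalLift t₀ τ (σ t₀)) := by
    rw [h_split, map_add, h.horizontal.self_of_nhds hq₀,
      h.vertical.self_of_nhds hq₀ j _ h_vertical]
  suffices fderiv ℂ (F₁ j) (t₀, σ t₀) (τ, σ' τ) - fderiv ℂ (F₂ j) (t₀, σ t₀) (τ, σ' τ) =
      ∑ k, (F₁ k (t₀, σ t₀) - F₂ k (t₀, σ t₀)) * connA t₀ j k τ by simpa [τ] using this
  rw [h_apply h₁, h_apply h₂]
  simp only [Fin.sum_univ_two]
  ring

theorem eventually_sub_eq_of_chart (h₁ : LocalPeriod t₀ q₀ F₁) (h₂ : LocalPeriod t₀ q₀ F₂)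
    (hc : Chart t₀ q₀ ℓ Ψ) :
    ∀ᶠ z in 𝓝 (t₀, q₀), z.2 ∈ E z.1 → ∀ j,
      F₁ j z - F₂ j z = F₁ j (z.1, Ψ (z.1, ℓ q₀)) - F₂ j (z.1, Ψ (z.1, ℓ q₀)) := by
  obtain ⟨ρ, hρ, h_ball⟩ := Metric.eventually_nhds_iff_ball.1
    ((hc.tendsto.eventually (h₁.differentiableAt.and h₁.vertical)).and
      ((hc.tendsto.eventually (h₂.differentiableAt.and h₂.vertical)).and
        (hc.eventually_isTangent.and (hc.mem.and (hc.contDiffAt.eventually (by simp))))))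
  have h_coord : Filter.Tendsto (fun z : (Fin 4 → ℂ) × ℂ × ℂ => (z.1, ℓ z.2)) (𝓝 (t₀, q₀))
    (𝓝 (t₀, ℓ q₀)) := Continuous.tendsto (by fun_prop) (t₀, q₀)
  filter_upwards [h_coord.eventually (Metric.ball_mem_nhds _ hρ), hc.inv] with z hz h_inv hzE j
  replace hz : (z.1, ℓ z.2) ∈ Metric.ball (t₀, ℓ q₀) ρ := hz
  rw [← ball_prod_same] at hz h_ball
  have h_deriv (u : ℂ) (hu : u ∈ Metric.ball (ℓ q₀) ρ) :
      HasDerivAt (fun u => F₁ j (z.1, Ψ (z.1, u)) - F₂ j (z.1, Ψ (z.1, u))) 0 u := by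
    obtain ⟨⟨h_diff₁, h_vert₁⟩, ⟨h_diff₂, h_vert₂⟩, h_tangent, ⟨hE, -⟩, hΨ⟩ :=
      h_ball (z.1, u) ⟨hz.1, hu⟩
    have h_point := (hasDerivAt_const u z.1).prodMk
      (hasDerivAt_slice (hΨ.differentiableAt two_ne_zero))
    refine (((h_diff₁ j).hasFDerivAt.comp_hasDerivAt u h_point).sub
      ((h_diff₂ j).hasFDerivAt.comp_hasDerivAt u h_point)).congr_deriv ?_
    rw [h_vert₁ hE j _ (h_tangent 0 1).1, h_vert₂ hE j _ (h_tangent 0 1).1, sub_self]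
  have h_const := Metric.isOpen_ball.is_const_of_deriv_eq_zero (convex_ball (ℓ q₀) ρ).isPreconnected
    (fun u hu => (h_deriv u hu).differentiableAt.differentiableWithinAt)
    (fun u hu => (h_deriv u hu).deriv) hz.2 (Metric.mem_ball_self hρ)
  simpa only [h_inv hzE] using h_const

theorem exists_sub_eq (h₁ : LocalPeriod t₀ q₀ F₁) (h₂ : LocalPeriod t₀ q₀ F₂) (ht : t₀ ∈ T)
    (hq₀ : q₀ ∈ E t₀) :
    ∃ c, IsHorizontalAt c t₀ ∧
      ∀ᶠ z in 𝓝 (t₀, q₀), z.2 ∈ E z.1 → ∀ j, F₁ j z - F₂ j z = c j z.1 := by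
  obtain ⟨ℓ, hℓ⟩ := SeparatingDual.exists_ne_zero (R := ℂ) (hamiltonianField_ne_zero ht hq₀)
  obtain ⟨Ψ, hc⟩ := exists_chart hq₀ hℓ
  have hΨ := HasFDerivAt.comp (f := fun t => (t, ℓ q₀)) t₀
    (hc.contDiffAt.differentiableAt two_ne_zero).hasFDerivAt (hasFDerivAt_prodMk_left t₀ (ℓ q₀))
  refine ⟨_, h₁.isHorizontalAt_sub_comp h₂ ht hq₀ hΨ hc.base fun τ => ?_,
    h₁.eventually_sub_eq_of_chart h₂ hc⟩
  simpa [hc.base] using (hc.eventually_isTangent.self_of_nhds τ 0).1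

end LocalPeriod

end LocalPeriod

namespace CycleFamily

variable {U : Set (Fin 4 → ℂ)} {δ : CycleFamily U} {t t₀ : Fin 4 → ℂ} {s s' x : ℝ} {j : Fin 2}

/-- The cycles, as functions of a real parameter. -/
def curve (δ : CycleFamily U) (t : Fin 4 → ℂ) (s : ℝ) : ℂ × ℂ :=
  (δ.loop t).extend s

/-- The velocity of the cycles. -/
def velocity (δ : CycleFamily U) (t : Fin 4 → ℂ) (s : ℝ) : ℂ × ℂ :=
  derivWithin (δ.curve t) (Set.Icc 0 1) s

theorem curve_mem_E (ht : t ∈ U) (s : ℝ) : δ.curve t s ∈ E t :=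
  δ.mem_E t ht (Set.projIcc 0 1 zero_le_one s)

theorem curve_one : δ.curve t 1 = δ.curve t 0 := by
  simp [curve]

theorem hasDerivWithinAt_curve (ht : t ∈ U) (hs : s ∈ Set.Icc (0 : ℝ) 1) :
    HasDerivWithinAt (δ.curve t) (δ.velocity t s) (Set.Icc 0 1) s :=
  ((δ.contDiffOn t ht).differentiableOn one_ne_zero s hs).hasDerivWithinAt

theorem continuousOn_velocity (ht : t ∈ U) : ContinuousOn (δ.velocity t) (Set.Icc 0 1) :=
  (δ.contDiffOn t ht).continuousOn_derivWithin (uniqueDiffOn_Icc zero_lt_one) le_rfl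

theorem isTangent_velocity (ht : t ∈ U) (hs : s ∈ Set.Icc (0 : ℝ) 1) :
    IsTangent t (δ.curve t s) 0 (δ.velocity t s) := by
  have h_curveEq := (contDiff_curveEq.differentiable one_ne_zero (t, δ.curve t s)).hasFDerivAt
  have h_chain := (h_curveEq.restrictScalars ℝ).comp_hasDerivWithinAt s
    ((hasDerivWithinAt_const s _ t).prodMk (δ.hasDerivWithinAt_curve ht hs))
  have h_zero : HasDerivWithinAt (curveEq ∘ fun s => (t, δ.curve t s)) 0 (Set.Icc 0 1) s :=
    (hasDerivWithinAt_const s _ (0 : ℂ)).congr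
      (fun s _ => mem_E_iff.1 (δ.curve_mem_E ht s)) (mem_E_iff.1 (δ.curve_mem_E ht s))
  exact isTangent_iff.2 ((uniqueDiffOn_Icc zero_lt_one s hs).eq_deriv _ h_chain h_zero)

theorem tendsto_curve (hU : IsOpen U) (ht₀ : t₀ ∈ U) (s : ℝ) :
    Filter.Tendsto (fun z : (Fin 4 → ℂ) × ℝ => (z.1, δ.curve z.1 z.2)) (𝓝 (t₀, s))
      (𝓝 (t₀, δ.curve t₀ s)) := by
  have h_loop : ContinuousAt (fun q : (Fin 4 → ℂ) × unitInterval => δ.loop q.1 q.2)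
      (t₀, Set.projIcc 0 1 zero_le_one s) :=
    δ.continuousOn.continuousAt ((hU.prod isOpen_univ).mem_nhds ⟨ht₀, Set.mem_univ _⟩)
  have h_proj : ContinuousAt
      (fun z : (Fin 4 → ℂ) × ℝ => (z.1, Set.projIcc (0 : ℝ) 1 zero_le_one z.2)) (t₀, s) := by
    fun_prop
  have h_curve : ContinuousAt (fun z : (Fin 4 → ℂ) × ℝ => δ.curve z.1 z.2) (t₀, s) :=
    ContinuousAt.comp (g := fun q : (Fin 4 → ℂ) × unitInterval => δ.loop q.1 q.2)
      (f := fun z : (Fin 4 → ℂ) × ℝ => (z.1, Set.projIcc (0 : ℝ) 1 zero_le_one z.2)) h_loop h_proj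
  exact continuousAt_fst.prodMk h_curve

theorem tendsto_curve_left (hU : IsOpen U) (ht₀ : t₀ ∈ U) (s : ℝ) :
    Filter.Tendsto (fun t => (t, δ.curve t s)) (𝓝 t₀) (𝓝 (t₀, δ.curve t₀ s)) :=
  (tendsto_curve hU ht₀ s).comp ((continuous_id.prodMk continuous_const).tendsto t₀)

theorem continuousOn_ω_velocity (hUT : U ⊆ T) (ht : t ∈ U) :
    ContinuousOn (fun s => ω t j (δ.curve t s) (δ.velocity t s)) (Set.Icc 0 1) := by
  intro s hs
  obtain ⟨ℓ, hℓ⟩ := SeparatingDual.exists_ne_zero (R := ℂ)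
    (hamiltonianField_ne_zero (hUT ht) (δ.curve_mem_E ht s))
  have h_curve : ContinuousWithinAt (fun s => (t, δ.curve t s)) (Set.Icc 0 1) s :=
    continuousWithinAt_const.prodMk (δ.hasDerivWithinAt_curve ht hs).continuousWithinAt
  have h_coeff := (contDiffAt_formCoeff (n := 1) (j := j) hℓ).continuousAt
    |>.comp_continuousWithinAt (f := fun s => (t, δ.curve t s)) h_curve
  have h_velocity := ℓ.continuous.continuousAt.comp_continuousWithinAt
    (δ.continuousOn_velocity ht s hs)
  refine (h_coeff.mul h_velocity).congr_of_eventuallyEq ?_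
    (ω_eq_formCoeff_mul (hUT ht) (δ.curve_mem_E ht s) hℓ (δ.isTangent_velocity ht hs))
  filter_upwards [h_curve.eventually (eventually_apply_hamiltonianField_ne_zero hℓ),
    self_mem_nhdsWithin] with s' hℓ' hs'
  exact ω_eq_formCoeff_mul (hUT ht) (δ.curve_mem_E ht s') hℓ' (δ.isTangent_velocity ht hs')

/-- The integral of `ω_j` along the arc of the cycle `δ_t` from time `s` to time `s'`. -/
def arcPeriod (δ : CycleFamily U) (j : Fin 2) (t : Fin 4 → ℂ) (s s' : ℝ) : ℂ :=
  ∫ x in s..s', ω t j (δ.curve t x) (δ.velocity t x)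

theorem arcPeriod_zero_one : δ.arcPeriod j t 0 1 = δ.period j t := by
  simp only [arcPeriod, period, curveIntegral_def, curveIntegralFun_def]
  rfl

theorem arcPeriod_symm : δ.arcPeriod j t s' s = -δ.arcPeriod j t s s' :=
  intervalIntegral.integral_symm s s'

theorem intervalIntegrable_ω_velocity (hUT : U ⊆ T) (ht : t ∈ U) (hs : s ∈ Set.Icc (0 : ℝ) 1)
    (hs' : s' ∈ Set.Icc (0 : ℝ) 1) :
    IntervalIntegrable (fun x => ω t j (δ.curve t x) (δ.velocity t x)) volume s s' :=
  ((continuousOn_ω_velocity hUT ht).mono (Set.uIcc_subset_Icc hs hs')).intervalIntegrable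

theorem arcPeriod_add_arcPeriod (hUT : U ⊆ T) (ht : t ∈ U) (hs : s ∈ Set.Icc (0 : ℝ) 1)
    (hx : x ∈ Set.Icc (0 : ℝ) 1) (hs' : s' ∈ Set.Icc (0 : ℝ) 1) :
    δ.arcPeriod j t s x + δ.arcPeriod j t x s' = δ.arcPeriod j t s s' :=
  intervalIntegral.integral_add_adjacent_intervals (intervalIntegrable_ω_velocity hUT ht hs hx)
    (intervalIntegrable_ω_velocity hUT ht hx hs')

theorem arcPeriod_eq_sub {F : (Fin 4 → ℂ) × ℂ × ℂ → ℂ} (hUT : U ⊆ T) (ht : t ∈ U)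
    (hs : s ∈ Set.Icc (0 : ℝ) 1) (hs' : s' ∈ Set.Icc (0 : ℝ) 1)
    (hF : ∀ x ∈ Set.uIcc s s', DifferentiableAt ℂ F (t, δ.curve t x) ∧
      fderiv ℂ F (t, δ.curve t x) (0, δ.velocity t x) = ω t j (δ.curve t x) (δ.velocity t x)) :
    δ.arcPeriod j t s s' = F (t, δ.curve t s') - F (t, δ.curve t s) := by
  have h_sub : Set.uIcc s s' ⊆ Set.Icc 0 1 := Set.uIcc_subset_Icc hs hs'
  have h_deriv (x : ℝ) (hx : x ∈ Set.uIcc s s') : HasDerivWithinAt (fun x => F (t, δ.curve t x))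
      (ω t j (δ.curve t x) (δ.velocity t x)) (Set.uIcc s s') x := by
    rw [← (hF x hx).2]
    exact ((hF x hx).1.hasFDerivAt.restrictScalars ℝ).comp_hasDerivWithinAt x
      ((hasDerivWithinAt_const x _ t).prodMk ((hasDerivWithinAt_curve ht (h_sub hx)).mono h_sub))
  exact intervalIntegral.integral_eq_sub_of_hasDeriv_right
    (fun x hx => (h_deriv x hx).continuousWithinAt)
    (fun x hx => ((h_deriv x (Set.Ioo_subset_Icc_self hx)).hasDerivAt
      (Icc_mem_nhds hx.1 hx.2)).hasDerivWithinAt)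
    (intervalIntegrable_ω_velocity hUT ht hs hs')

theorem eventually_arcPeriod_eq_sub {F : Fin 2 → (Fin 4 → ℂ) × ℂ × ℂ → ℂ} (hU : IsOpen U)
    (hUT : U ⊆ T) (ht₀ : t₀ ∈ U) (hs : s ∈ Set.Icc (0 : ℝ) 1)
    (hF : LocalPeriod t₀ (δ.curve t₀ s) F) :
    ∀ᶠ s' in 𝓝[Set.Icc 0 1] s, ∀ᶠ t in 𝓝 t₀, ∀ j,
      δ.arcPeriod j t s s' = F j (t, δ.curve t s') - F j (t, δ.curve t s) := by
  have h_prim := (tendsto_curve hU ht₀ s).eventually (hF.differentiableAt.and hF.vertical)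
  rw [nhds_prod_eq] at h_prim
  obtain ⟨N, hN, M, hM, h⟩ := Filter.eventually_prod_iff.1 h_prim
  obtain ⟨ε, hε, h_ball⟩ := Metric.eventually_nhds_iff_ball.1 hM
  filter_upwards [nhdsWithin_le_nhds (Metric.ball_mem_nhds s hε), self_mem_nhdsWithin]
    with s' h_near hs'
  filter_upwards [hN, hU.mem_nhds ht₀] with t htN ht j
  refine arcPeriod_eq_sub hUT ht hs hs' fun x hx => ?_
  obtain ⟨h_diff, h_vert⟩ := h htN (h_ball x
    ((convex_ball s ε).segment_subset (Metric.mem_ball_self hε) h_near (segment_eq_uIcc s s' ▸ hx)))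
  exact ⟨h_diff j, h_vert (curve_mem_E ht x) j _
    (isTangent_velocity ht (Set.uIcc_subset_Icc hs hs' hx))⟩

/-- The arc periods from `s` to `s'` are given by local primitives at its endpoints, up to functions
of the parameters that satisfy the Gauss–Manin equation. -/
def IsTransport (δ : CycleFamily U) (t₀ : Fin 4 → ℂ) (s s' : ℝ) : Prop :=
  ∀ F F', LocalPeriod t₀ (δ.curve t₀ s) F → LocalPeriod t₀ (δ.curve t₀ s') F' →
    IsHorizontalAt (fun j t =>
      δ.arcPeriod j t s s' - (F' j (t, δ.curve t s') - F j (t, δ.curve t s))) t₀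

theorem eventually_isTransport (hU : IsOpen U) (hUT : U ⊆ T) (ht₀ : t₀ ∈ U)
    (hs : s ∈ Set.Icc (0 : ℝ) 1) : ∀ᶠ s' in 𝓝[Set.Icc 0 1] s, δ.IsTransport t₀ s s' := by
  have h_mem (x : ℝ) := δ.curve_mem_E ht₀ x
  obtain ⟨G, hG⟩ := exists_localPeriod (hUT ht₀) (h_mem s)
  have h_curve : ContinuousWithinAt (δ.curve t₀) (Set.Icc 0 1) s :=
    (hasDerivWithinAt_curve ht₀ hs).continuousWithinAt
  filter_upwards [eventually_arcPeriod_eq_sub hU hUT ht₀ hs hG, h_curve.eventually hG.eventually]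
    with s' h_arc hG' F F' hF hF'
  obtain ⟨c, hc, h_sub⟩ := hF.exists_sub_eq hG (hUT ht₀) (h_mem s)
  obtain ⟨c', hc', h_sub'⟩ := hF'.exists_sub_eq hG' (hUT ht₀) (h_mem s')
  refine (hc.add hc'.neg).congr_of_eventuallyEq ?_
  filter_upwards [h_arc, (tendsto_curve_left hU ht₀ s).eventually h_sub,
    (tendsto_curve_left hU ht₀ s').eventually h_sub', hU.mem_nhds ht₀]
    with t h_arc h_sub h_sub' ht j
  simp only [Pi.add_apply, Pi.neg_apply]
  linear_combination h_arc j + h_sub (curve_mem_E ht s) j - h_sub' (curve_mem_E ht s') j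

theorem IsTransport.symm (h : δ.IsTransport t₀ s s') : δ.IsTransport t₀ s' s := by
  refine fun F F' hF hF' => (h F' F hF' hF).neg.congr_of_eventuallyEq (.of_forall fun t j => ?_)
  simp only [Pi.neg_apply, arcPeriod_symm (s := s)]
  ring

theorem IsTransport.trans (hU : IsOpen U) (hUT : U ⊆ T) (ht₀ : t₀ ∈ U)
    (hs : s ∈ Set.Icc (0 : ℝ) 1) (hx : x ∈ Set.Icc (0 : ℝ) 1) (hs' : s' ∈ Set.Icc (0 : ℝ) 1)
    (h : δ.IsTransport t₀ s x) (h' : δ.IsTransport t₀ x s') : δ.IsTransport t₀ s s' := by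
  intro F F' hF hF'
  obtain ⟨G, hG⟩ := exists_localPeriod (hUT ht₀) (δ.curve_mem_E ht₀ x)
  refine ((h F G hF hG).add (h' G F' hG hF')).congr_of_eventuallyEq ?_
  filter_upwards [hU.mem_nhds ht₀] with t ht j
  simp only [Pi.add_apply, ← arcPeriod_add_arcPeriod hUT ht hs hx hs']
  ring

theorem isTransport (hU : IsOpen U) (hUT : U ⊆ T) (ht₀ : t₀ ∈ U) (hs : s ∈ Set.Icc (0 : ℝ) 1)
    (hs' : s' ∈ Set.Icc (0 : ℝ) 1) : δ.IsTransport t₀ s s' :=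
  isPreconnected_Icc.induction₂ (δ.IsTransport t₀)
    (fun _ hs => eventually_isTransport hU hUT ht₀ hs)
    (fun _ _ _ hs hx hs' => IsTransport.trans hU hUT ht₀ hs hx hs')
    (fun _ _ _ _ => IsTransport.symm) hs hs'

theorem isHorizontalAt_period (hU : IsOpen U) (hUT : U ⊆ T) (ht₀ : t₀ ∈ U) :
    IsHorizontalAt δ.period t₀ := by
  obtain ⟨F, hF⟩ := exists_localPeriod (hUT ht₀) (δ.curve_mem_E ht₀ 0)
  have h := isTransport hU hUT ht₀ (δ := δ) (Set.left_mem_Icc.2 zero_le_one)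
    (Set.right_mem_Icc.2 zero_le_one) F F hF (by rwa [curve_one])
  simpa only [arcPeriod_zero_one, curve_one, sub_self, sub_zero] using h

end CycleFamily

end EllipticFamily

end

theorem proposition1 :
    -- `d pm = pm · Aᵗʳ`, entry by entry, for every local branch of the period matrix
    (∀ (U : Set (Fin 4 → ℂ)) (_ : IsOpen U) (_ : U ⊆ EllipticFamily.T)
        (δ : Fin 2 → EllipticFamily.CycleFamily U) (t : Fin 4 → ℂ) (_ : t ∈ U) (a b : Fin 2),
      HasFDerivAt (fun s => EllipticFamily.pm δ s a b)
        (∑ c : Fin 2, EllipticFamily.pm δ t a c • (EllipticFamily.connA t).transpose c b) t) ∧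
    -- `∇ ω = A ω` for the Gauss-Manin connection `∇` on the classes modulo exact forms
    (∀ (L : Type*) [Field L] [Algebra EllipticFamily.K L] (x y : L)
        (_ : EllipticFamily.IsFunctionField x y) (i : Fin 4) (D : Derivation ℤ L L)
        (_ : EllipticFamily.ExtendsPartial i D) (j : Fin 2),
      (EllipticFamily.exactForms L).mkQ
          (EllipticFamily.lieDerivative D (x ^ (j : ℕ) / y) x) =
        ∑ k : Fin 2,
          (1 / EllipticFamily.disc EllipticFamily.tK *
              EllipticFamily.matA EllipticFamily.tK i j k) •
            (EllipticFamily.exactForms L).mkQ (EllipticFamily.ωK x y k)) := by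
  refine ⟨fun U hU hUT δ t ht a b => ?_, fun L _ _ x y h i D hD j =>
    EllipticFamily.mkQ_lieDerivative h hD j⟩
  refine ((EllipticFamily.CycleFamily.isHorizontalAt_period hU hUT ht b).const_mul
    _).congr_fderiv ?_
  simp only [EllipticFamily.pm, Matrix.of_apply, Matrix.transpose_apply, Finset.smul_sum, smul_smul]
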